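/- Let $M$ be a connected complex manifold of complex dimension $2$, with holomorphic tangent bundle $T'M$ (local coordinates $(z^k,\eta^k)$, $k=1,2$), and let $(M,F)$ be a complex Finsler space: $F:T'M\to[0,\infty)$ is continuous, $L:=F^2$ is smooth on $\widetilde{T'M}=T'M\setminus\{0\}$, $F(z,\eta)=0$ iff $\eta=0$, $F(z,\lambda\eta)=|\lambda|F(z,\eta)$ for $\lambda\in\mathbb C$, and the Hermitian matrix $g_{i\bar j}:=\partial^2L/\partial\eta^i\partial\bar\eta^j$ is positive definite on $\widetilde{T'M}$. Let $(g^{\bar m k})$ be the inverse of $(g_{l\bar m})$, so that $\sum_m g_{l\bar m}g^{\bar m k}$ is $1$ if $l=k$ and $0$ otherwise, and put (with summation over repeated indices) $$N_j^k=g^{\bar m k}\frac{\partial g_{l\bar m}}{\partial z^j}\eta^l,\qquad \delta_k=\frac{\partial}{\partial z^k}-N_k^j\frac{\partial}{\partial\eta^j},\qquad \delta_{\bar k}=\overline{\delta_k},\qquad L^i_{jk}=g^{\bar l i}\delta_k g_{j\bar l},\qquad C^i_{jk}=g^{\bar l i}\frac{\partial g_{j\bar l}}{\partial\eta^k},$$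 $$R^i_{j\bar hk}=-\delta_{\bar h}L^i_{jk}-\delta_{\bar h}(N^l_k)\,C^i_{jl},\qquad R_{\bar rj\bar hk}=g_{l\bar r}R^l_{j\bar hk}$$ (the Chern–Finsler connection and its horizontal curvature). Suppose that there is a real-valued function $\mathcal K=\mathcal K(z,\eta)$ such that, in local coordinates, $$R_{\bar rj\bar hk}=\mathcal K\,\bigl(g_{j\bar r}g_{k\bar h}+g_{k\bar r}g_{j\bar h}\bigr)\quad\text{on }\widetilde{T'M}\text{ for all }r,j,h,k\in\{1,2\}.$$ Then either $(M,F)$ is purely Hermitian (that is, in all local coordinates $g_{i\bar j}=g_{i\bar j}(z)$ does not depend on $\eta$) and $\mathcal K$ is a function of $z$ alone on $\widetilde{T'M}$, or $(M,F)$ is not purely Hermitian and $\mathcal K=0$ on all of $\widetilde{T'M}$. -/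

import Mathlib

open scoped Manifold ContDiff ComplexConjugate ComplexOrder

noncomputable section

namespace CFinsler

/-! ### Wirtinger derivatives -/

section Wirtinger

variable {V : Type*} [NormedAddCommGroup V] [NormedSpace ℂ V]

/-- The `(1,0)` part of the real differential of `f` at `u`, in the direction `v`:
`½ (Df(v) - i Df(iv))`. For `v` a coordinate vector this is `∂f/∂w`. -/
def wirt (f : V → ℂ) (v u : V) : ℂ :=
  (1 / 2 : ℂ) * (fderiv ℝ f u v - Complex.I * fderiv ℝ f u (Complex.I • v))

/-- The `(0,1)` part of the real differential of `f` at `u`, in the direction `v`: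
`½ (Df(v) + i Df(iv))`. For `v` a coordinate vector this is `∂f/∂w̄`. -/
def wirtBar (f : V → ℂ) (v u : V) : ℂ :=
  (1 / 2 : ℂ) * (fderiv ℝ f u v + Complex.I * fderiv ℝ f u (Complex.I • v))

end Wirtinger

/-- The space `ℂⁿ` of coordinates `z = (z¹, …, zⁿ)` (only its topology and linear structure
matter). -/
abbrev Cn (n : ℕ) : Type := Fin n → ℂ

variable {n : ℕ}

/-- `∂f/∂zᵏ` for a function `f` of `(z, η)`. -/
def dz (k : Fin n) (f : Cn n × Cn n → ℂ) (u : Cn n × Cn n) : ℂ :=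
  wirt f (Pi.single k 1, 0) u

/-- `∂f/∂z̄ᵏ`. -/
def dzBar (k : Fin n) (f : Cn n × Cn n → ℂ) (u : Cn n × Cn n) : ℂ :=
  wirtBar f (Pi.single k 1, 0) u

/-- `∂f/∂ηᵏ`. -/
def dEta (k : Fin n) (f : Cn n × Cn n → ℂ) (u : Cn n × Cn n) : ℂ :=
  wirt f (0, Pi.single k 1) u

/-- `∂f/∂η̄ᵏ`. -/
def dEtaBar (k : Fin n) (f : Cn n × Cn n → ℂ) (u : Cn n × Cn n) : ℂ :=
  wirtBar f (0, Pi.single k 1) u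

/-! ### Local geometry: the Chern–Finsler connection of a function `L(z, η)` -/

/-- Fundamental tensor `g_{i j̄} = ∂²L / ∂ηⁱ ∂η̄ʲ`. -/
def g (L : Cn n × Cn n → ℂ) (i j : Fin n) (u : Cn n × Cn n) : ℂ :=
  dEta i (dEtaBar j L) u

/-- The matrix `(g_{i j̄})`, rows indexed by `i`, columns by `j`. -/
def gMatrix (L : Cn n × Cn n → ℂ) (u : Cn n × Cn n) : Matrix (Fin n) (Fin n) ℂ :=
  Matrix.of fun i j => g L i j u

/-- The inverse tensor `g^{m̄ k}`, determined by `∑ₘ g_{l m̄} g^{m̄ k} = δ_lᵏ`. -/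
def gInv (L : Cn n × Cn n → ℂ) (m k : Fin n) (u : Cn n × Cn n) : ℂ :=
  (gMatrix L u)⁻¹ m k

/-- Coefficients of the Chern–Finsler nonlinear connection,
`N k j = Nⱼᵏ = ∑ g^{m̄ k} (∂g_{l m̄}/∂zʲ) ηˡ` (upper index first). -/
def N (L : Cn n × Cn n → ℂ) (k j : Fin n) (u : Cn n × Cn n) : ℂ :=
  ∑ m, ∑ l, gInv L m k u * dz j (g L l m) u * u.2 l

/-- The adapted derivative `δ_k = ∂/∂zᵏ - ∑ⱼ N_kʲ ∂/∂ηʲ`. -/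
def del (L : Cn n × Cn n → ℂ) (k : Fin n) (f : Cn n × Cn n → ℂ) (u : Cn n × Cn n) : ℂ :=
  dz k f u - ∑ j, N L j k u * dEta j f u

/-- The conjugate adapted derivative `δ_k̄ = ∂/∂z̄ᵏ - ∑ⱼ conj(N_kʲ) ∂/∂η̄ʲ`. -/
def delBar (L : Cn n × Cn n → ℂ) (k : Fin n) (f : Cn n × Cn n → ℂ) (u : Cn n × Cn n) : ℂ :=
  dzBar k f u - ∑ j, conj (N L j k u) * dEtaBar j f u

/-- Horizontal coefficients of the Chern–Finsler connection,
`hCoeff i j k = L^i_{jk} = ∑ₗ g^{l̄ i} δ_k g_{j l̄}`. -/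
def hCoeff (L : Cn n × Cn n → ℂ) (i j k : Fin n) (u : Cn n × Cn n) : ℂ :=
  ∑ l, gInv L l i u * del L k (g L j l) u

/-- Vertical coefficients of the Chern–Finsler connection,
`vCoeff i j k = C^i_{jk} = ∑ₗ g^{l̄ i} ∂g_{j l̄}/∂ηᵏ`. -/
def vCoeff (L : Cn n × Cn n → ℂ) (i j k : Fin n) (u : Cn n × Cn n) : ℂ :=
  ∑ l, gInv L l i u * dEta k (g L j l) u

/-- The `h h̄`-curvature coefficients,
`hCurv i j h k = R^i_{j h̄ k} = -δ_h̄ L^i_{jk} - ∑ₗ δ_h̄(N_kˡ) C^i_{jl}`. -/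
def hCurv (L : Cn n × Cn n → ℂ) (i j h k : Fin n) (u : Cn n × Cn n) : ℂ :=
  -delBar L h (hCoeff L i j k) u - ∑ l, delBar L h (N L l k) u * vCoeff L i j l u

/-- The `h h̄`-Riemann type tensor, `Riem r j h k = R_{r̄ j h̄ k} = ∑ₗ g_{l r̄} R^l_{j h̄ k}`. -/
def Riem (L : Cn n × Cn n → ℂ) (r j h k : Fin n) (u : Cn n × Cn n) : ℂ :=
  ∑ l, g L l r u * hCurv L l j h k u

/-! ### Complex Finsler spaces -/

section Manifold

variable {M : Type*} [TopologicalSpace M] [ChartedSpace (Cn n) M]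

/-- The tangent vector `∑ ηᵏ ∂/∂zᵏ` at the point with coordinates `z` in the chart `e`, for
`u = (z, η)`. The tangent bundle of the complex manifold `M`, with its complex structure on the
fibres, is the holomorphic tangent bundle `T'M`. -/
def coordVec (e : OpenPartialHomeomorph M (Cn n)) (u : Cn n × Cn n) :
    TangentBundle 𝓘(ℂ, Cn n) M :=
  ⟨e.symm u.1, mfderiv 𝓘(ℂ, Cn n) 𝓘(ℂ, Cn n) e.symm u.1 u.2⟩

/-- The coordinates `(z, η)`, `η ≠ 0`, of the nonzero tangent vectors over the domain of the
chart `e`. -/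
def slitDomain (e : OpenPartialHomeomorph M (Cn n)) : Set (Cn n × Cn n) :=
  {u | u.1 ∈ e.target ∧ u.2 ≠ 0}

/-- The function `L = F²` in the coordinates `(z, η)` induced by the chart `e`. -/
def localL (F : TangentBundle 𝓘(ℂ, Cn n) M → ℝ) (e : OpenPartialHomeomorph M (Cn n))
    (u : Cn n × Cn n) : ℂ :=
  ((F (coordVec e u) ^ 2 : ℝ) : ℂ)

/-- `F` makes the complex manifold `M` a complex Finsler space. -/
structure IsComplexFinsler [IsManifold 𝓘(ℂ, Cn n) ω M]
    (F : TangentBundle 𝓘(ℂ, Cn n) M → ℝ) : Prop where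
  continuous : Continuous F
  /-- `L = F²` is smooth (in the real sense) off the zero section. -/
  smooth : ∀ e ∈ atlas (Cn n) M, ContDiffOn ℝ ∞ (localL F e) (slitDomain e)
  nonneg : ∀ x, 0 ≤ F x
  eq_zero_iff : ∀ (p : M) (v : TangentSpace 𝓘(ℂ, Cn n) p), F ⟨p, v⟩ = 0 ↔ v = 0
  homogeneous : ∀ (p : M) (v : TangentSpace 𝓘(ℂ, Cn n) p) (c : ℂ),
    F ⟨p, c • v⟩ = ‖c‖ * F ⟨p, v⟩
  posDef : ∀ e ∈ atlas (Cn n) M, ∀ u ∈ slitDomain e, (gMatrix (localL F e) u).PosDef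

/-- `F` is purely Hermitian: in every chart, the fundamental tensor depends on `z` only. -/
def IsPurelyHermitian (F : TangentBundle 𝓘(ℂ, Cn n) M → ℝ) : Prop :=
  ∀ e ∈ atlas (Cn n) M, ∃ a : Cn n → Matrix (Fin n) (Fin n) ℂ,
    ∀ u ∈ slitDomain e, gMatrix (localL F e) u = a u.1

/-- The curvature condition `R_{r̄ j h̄ k} = 𝒦 (g_{j r̄} g_{k h̄} + g_{k r̄} g_{j h̄})` off the zero
section, for a real function `𝒦 = 𝒦(z, η)`. -/
def HasCurvatureForm (F 𝒦 : TangentBundle 𝓘(ℂ, Cn n) M → ℝ) : Prop :=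
  ∀ e ∈ atlas (Cn n) M, ∀ u ∈ slitDomain e, ∀ r j h k : Fin n,
    Riem (localL F e) r j h k u =
      (𝒦 (coordVec e u) : ℂ) *
        (g (localL F e) j r u * g (localL F e) k h u +
          g (localL F e) k r u * g (localL F e) j h u)

end Manifold

end CFinsler

end

noncomputable section

namespace CFinsler

/-! Write L_k = ∂L/∂ηᵏ, L_h̄ = ∂L/∂η̄ʰ, L_jk = ∂²L/∂ηʲ∂ηᵏ. Contracting the curvature equation with
ηʲ gives δ_h̄ Nⁱ_k = -𝒦(ηⁱ g_{kh̄} + δⁱ_k L_h̄). Differentiating this in ηʲ and contracting with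
L_i, which annihilates the commutator term, yields `curvature_identity`: (∂𝒦/∂ηʲ)(L g_{kh̄} + L_k
L_h̄) + 𝒦(L ∂g_{kh̄}/∂ηʲ + L_h̄ L_jk) = 0. Contractions with η̄ and η, together with the symmetry of
L_jk, force ∂𝒦/∂ηʲ = 0 (`E_scalar_curvature`), and then 𝒦 ∂g_{kh̄}/∂ηʲ = 0
(`scalar_curvature_mul_E_g`). Since 𝒦 is real and punctured fibres are connected, 𝒦 is a function on
M, and the metric is Hermitian wherever 𝒦 ≠ 0.

There, ∂∂̄ log det g is a multiple of 𝒦g, so the (1,1)-form with coefficients 𝒦g_{kh̄} is ∂-closed.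
In dimension at least 2 this gives ∂𝒦 = 𝒦·(torsion trace) (`D_scalar_curvature`). Multiplied by 𝒦,
the relation also holds at zeros of 𝒦; a Grönwall estimate for 𝒦² along coordinate segments makes
the zero set of 𝒦 open (`isClopen_curv_zero`). On connected M, 𝒦 therefore vanishes everywhere or
nowhere, and in the latter case the metric is purely Hermitian.

All tensor identities are proved for derivations of an abstract commutative algebra
(`FinslerAlgebra`) and transferred to functions through `Rep`. -/

theorem derivation_inverse {n : ℕ} {R A : Type*} [CommRing R] [CommRing A]
    [Algebra R A] (δ : Derivation R A A)
    {G H : Fin n → Fin n → A}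
    (h1 : ∀ l k, ∑ m, G l m * H m k = if l = k then 1 else 0)
    (h2 : ∀ l k, ∑ m, H l m * G m k = if l = k then 1 else 0) (a b : Fin n) :
    δ (H a b) = -∑ l, ∑ m, H a l * δ (G l m) * H m b := by
  have h3 : ∀ l, ∑ m, G l m * δ (H m b) = -∑ m, H m b * δ (G l m) := by
    intro l
    have h := congrArg δ (h1 l b)
    have h0 : δ (if l = b then (1 : A) else 0) = 0 := by split_ifs <;> simp
    simp only [map_sum, Derivation.leibniz, smul_eq_mul, Finset.sum_add_distrib, h0] at h
    linear_combination h
  calc δ (H a b) = ∑ m, (∑ l, H a l * G l m) * δ (H m b) := by simp [h2]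
    _ = ∑ l, H a l * ∑ m, G l m * δ (H m b) := by
        simp only [Finset.sum_mul, Finset.mul_sum]
        rw [Finset.sum_comm]
        exact Finset.sum_congr rfl fun _ _ => Finset.sum_congr rfl fun _ _ => by ring
    _ = _ := by
        simp only [h3, mul_neg, Finset.sum_neg_distrib, Finset.mul_sum]
        congr 1
        exact Finset.sum_congr rfl fun _ _ => Finset.sum_congr rfl fun _ _ => by ring

/-- The algebraic data underlying a Chern–Finsler connection: commuting families of derivations
`∂/∂zᵏ`, `∂/∂z̄ᵏ`, `∂/∂ηᵏ`, `∂/∂η̄ᵏ` of a commutative algebra, fibre coordinates and their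
conjugates, a homogeneous Lagrangian whose fundamental tensor is invertible, and the conjugate
nonlinear connection (which may be arbitrary here). -/
structure FinslerAlgebra (n : ℕ) (A : Type*) [CommRing A] [Algebra ℂ A] where
  /-- `∂/∂zᵏ` -/
  D : Fin n → Derivation ℂ A A
  /-- `∂/∂z̄ᵏ` -/
  Db : Fin n → Derivation ℂ A A
  /-- `∂/∂ηᵏ` -/
  E : Fin n → Derivation ℂ A A
  /-- `∂/∂η̄ᵏ` -/
  Eb : Fin n → Derivation ℂ A A
  D_D : ∀ i j x, D i (D j x) = D j (D i x)
  D_Db : ∀ i j x, D i (Db j x) = Db j (D i x)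
  E_E : ∀ i j x, E i (E j x) = E j (E i x)
  E_Eb : ∀ i j x, E i (Eb j x) = Eb j (E i x)
  E_D : ∀ i j x, E i (D j x) = D j (E i x)
  E_Db : ∀ i j x, E i (Db j x) = Db j (E i x)
  Eb_D : ∀ i j x, Eb i (D j x) = D j (Eb i x)
  /-- the fibre coordinates `ηᵏ` -/
  eta : Fin n → A
  /-- the conjugate fibre coordinates -/
  etab : Fin n → A
  E_eta : ∀ i j, E i (eta j) = if i = j then 1 else 0
  Eb_eta : ∀ i j, Eb i (eta j) = 0
  D_eta : ∀ i j, D i (eta j) = 0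
  Db_eta : ∀ i j, Db i (eta j) = 0
  E_etab : ∀ i j, E i (etab j) = 0
  D_etab : ∀ i j, D i (etab j) = 0
  /-- the Lagrangian `F²` -/
  L : A
  euler : ∑ i, eta i * E i L = L
  euler_bar : ∑ i, etab i * Eb i L = L
  L_cancel : ∀ x, L * x = 0 → x = 0
  /-- the inverse of the fundamental tensor -/
  gi : Fin n → Fin n → A
  g_gi : ∀ l k, ∑ m, E l (Eb m L) * gi m k = if l = k then 1 else 0
  gi_g : ∀ l k, ∑ m, gi l m * E m (Eb k L) = if l = k then 1 else 0
  /-- the conjugate nonlinear connection -/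
  Nb : Fin n → Fin n → A

/-! ### Identities of the Chern–Finsler connection that follow from homogeneity. -/

namespace FinslerAlgebra

variable {n : ℕ} {A : Type*} [CommRing A] [Algebra ℂ A] (S : FinslerAlgebra n A)

/-- fundamental tensor -/
def g (i j : Fin n) : A := S.E i (S.Eb j S.L)

/-- nonlinear connection -/
def N (k j : Fin n) : A := ∑ m, ∑ l, S.gi m k * S.D j (S.g l m) * S.eta l

/-- adapted derivative -/
def del (k : Fin n) (x : A) : A := S.D k x - ∑ j, S.N j k * S.E j x

/-- conjugate adapted derivative -/
def delBar (k : Fin n) (x : A) : A := S.Db k x - ∑ j, S.Nb j k * S.Eb j x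

/-- horizontal coefficients -/
def hCoeff (i j k : Fin n) : A := ∑ l, S.gi l i * S.del k (S.g j l)

/-- vertical coefficients -/
def vCoeff (i j k : Fin n) : A := ∑ l, S.gi l i * S.E k (S.g j l)

/-- horizontal curvature -/
def hCurv (i j h k : Fin n) : A :=
  -S.delBar h (S.hCoeff i j k) - ∑ l, S.delBar h (S.N l k) * S.vCoeff i j l

/-- Riemann type tensor -/
def Riem (r j h k : Fin n) : A := ∑ l, S.g l r * S.hCurv l j h k

theorem delBar_mul (h : Fin n) (x y : A) :
    S.delBar h (x * y) = x * S.delBar h y + y * S.delBar h x := by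
  simp only [delBar, Derivation.leibniz, smul_eq_mul, mul_sub, Finset.mul_sum, mul_add,
    Finset.sum_add_distrib]
  have h1 : ∀ x y : A, ∑ j, S.Nb j h * (x * S.Eb j y) = ∑ j, x * (S.Nb j h * S.Eb j y) :=
    fun x y => Finset.sum_congr rfl fun _ _ => by ring
  rw [h1 x y, h1 y x]
  ring

theorem delBar_sum {ι : Type*} (h : Fin n) (s : Finset ι) (f : ι → A) :
    S.delBar h (∑ i ∈ s, f i) = ∑ i ∈ s, S.delBar h (f i) := by
  simp only [delBar, map_sum, Finset.mul_sum, Finset.sum_sub_distrib]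
  rw [Finset.sum_comm]

theorem delBar_eta (h j : Fin n) : S.delBar h (S.eta j) = 0 := by
  simp [delBar, S.Db_eta, S.Eb_eta]

/-- Lowering an index is injective because the fundamental tensor is invertible; connection
identities are checked after lowering, where no inverse matrix appears. -/
theorem eq_of_lower {x y : Fin n → A} (h : ∀ m, ∑ k, S.g k m * x k = ∑ k, S.g k m * y k) :
    x = y := by
  have key : ∀ (x : Fin n → A) i, ∑ m, S.gi m i * ∑ k, S.g k m * x k = x i := by
    intro x i
    simp only [Finset.mul_sum]
    rw [Finset.sum_comm]
    calc ∑ k, ∑ m, S.gi m i * (S.g k m * x k)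
        = ∑ k, (∑ m, S.g k m * S.gi m i) * x k :=
          Finset.sum_congr rfl fun k _ => by
            rw [Finset.sum_mul]; exact Finset.sum_congr rfl fun m _ => by ring
      _ = x i := by simp [g, S.g_gi]
  funext i
  rw [← key x i, ← key y i]
  exact Finset.sum_congr rfl fun m _ => by rw [h m]

theorem lower_raise (v : Fin n → A) (m : Fin n) :
    ∑ k, S.g k m * ∑ l, S.gi l k * v l = v m := by
  simp only [Finset.mul_sum]
  rw [Finset.sum_comm]
  calc ∑ l, ∑ k, S.g k m * (S.gi l k * v l)
      = ∑ l, (∑ k, S.gi l k * S.g k m) * v l :=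
        Finset.sum_congr rfl fun k _ => by
          rw [Finset.sum_mul]; exact Finset.sum_congr rfl fun m _ => by ring
    _ = v m := by simp [g, S.gi_g]

theorem sum_eta_g (m : Fin n) : ∑ l, S.eta l * S.g l m = S.Eb m S.L := by
  conv_rhs => rw [← S.euler]
  simp [g, S.E_Eb, S.Eb_eta]

theorem sum_etab_g (i : Fin n) : ∑ m, S.etab m * S.g i m = S.E i S.L := by
  conv_rhs => rw [← S.euler_bar]
  simp [g, S.E_etab]

/-- The fundamental tensor has degree 0 in η; the symmetry of ∂g_{im̄}/∂ηᵏ in i, k moves the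
contraction to a tensor index. -/
theorem sum_eta_E_g (k m : Fin n) : ∑ i, S.eta i * S.E k (S.g i m) = 0 := by
  have h := congrArg (S.E k) (S.sum_eta_g m)
  simp only [map_sum, Derivation.leibniz, smul_eq_mul, S.E_eta, Finset.sum_add_distrib] at h
  simpa [g] using h

theorem E_g_symm (i j m : Fin n) : S.E i (S.g j m) = S.E j (S.g i m) := S.E_E i j _

theorem lower_N (j m : Fin n) : ∑ k, S.g k m * S.N k j = S.D j (S.Eb m S.L) := by
  have : ∀ k, S.N k j = ∑ l, S.gi l k * ∑ i, S.D j (S.g i l) * S.eta i := fun k => by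
    simp only [N, Finset.mul_sum, mul_assoc]
  simp only [this]
  rw [S.lower_raise (fun l => ∑ i, S.D j (S.g i l) * S.eta i), ← S.sum_eta_g]
  simp [S.D_eta, mul_comm]

/-- This is δ_j L = 0: the Lagrangian is horizontally constant. -/
theorem sum_EL_N (j : Fin n) : ∑ k, S.E k S.L * S.N k j = S.D j S.L := by
  calc ∑ k, S.E k S.L * S.N k j = ∑ m, S.etab m * ∑ k, S.g k m * S.N k j := by
        simp only [← S.sum_etab_g, Finset.mul_sum, Finset.sum_mul]
        rw [Finset.sum_comm]
        exact Finset.sum_congr rfl fun _ _ => Finset.sum_congr rfl fun _ _ => by ring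
    _ = S.D j S.L := by
        simp only [S.lower_N]
        conv_rhs => rw [← S.euler_bar]
        simp [S.D_etab]

/-- Differentiate δ_j L = 0 in η̄ˡ; the other two terms cancel by `lower_N`. This is what removes
the commutator of ∂/∂ηʲ and δ_h̄ from the curvature computation. -/
theorem sum_EL_Eb_N (l j : Fin n) : ∑ k, S.E k S.L * S.Eb l (S.N k j) = 0 := by
  have h := congrArg (S.Eb l) (S.sum_EL_N j)
  simp only [map_sum, Derivation.leibniz, smul_eq_mul, Finset.sum_add_distrib, S.Eb_D,
    ← S.lower_N, ← S.E_Eb] at h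
  have h2 : ∑ k, S.N k j * S.E k (S.Eb l S.L) = ∑ k, S.g k l * S.N k j :=
    Finset.sum_congr rfl fun _ _ => by rw [g, mul_comm]
  rw [h2] at h
  linear_combination h

theorem lower_hCoeff (i j m : Fin n) :
    ∑ k, S.g k m * S.hCoeff k i j = S.del j (S.g i m) := by
  simp only [hCoeff]
  exact S.lower_raise (fun l => S.del j (S.g i l)) m

/-- Differentiate the lowered formula `lower_N` in ηⁱ; the total symmetry of ∂g/∂η turns the
product-rule term into the vertical part of the adapted derivative. -/
theorem E_N (i k j : Fin n) : S.E i (S.N k j) = S.hCoeff k i j := by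
  refine congrFun (S.eq_of_lower (x := fun k => S.E i (S.N k j))
    (y := fun k => S.hCoeff k i j) fun m => ?_) k
  rw [S.lower_hCoeff]
  have h := congrArg (S.E i) (S.lower_N j m)
  simp only [map_sum, Derivation.leibniz, smul_eq_mul, Finset.sum_add_distrib, S.E_D] at h
  have h2 : ∑ k, S.N k j * S.E i (S.g k m) = ∑ k, S.N k j * S.E k (S.g i m) :=
    Finset.sum_congr rfl fun k _ => by rw [S.E_g_symm]
  rw [h2] at h
  simp only [del]
  rw [show S.D j (S.g i m) = S.D j (S.E i (S.Eb m S.L)) from rfl]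
  linear_combination h

theorem sum_eta_hCoeff (i k : Fin n) : ∑ j, S.eta j * S.hCoeff i j k = S.N i k := by
  refine congrFun (S.eq_of_lower (x := fun i => ∑ j, S.eta j * S.hCoeff i j k)
    (y := fun i => S.N i k) fun m => ?_) i
  rw [S.lower_N]
  calc ∑ i, S.g i m * ∑ j, S.eta j * S.hCoeff i j k
      = ∑ j, S.eta j * ∑ i, S.g i m * S.hCoeff i j k := by
        simp only [Finset.mul_sum]
        rw [Finset.sum_comm]
        exact Finset.sum_congr rfl fun _ _ => Finset.sum_congr rfl fun _ _ => by ring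
    _ = ∑ j, S.eta j * S.D k (S.g j m)
          - ∑ l, S.N l k * ∑ j, S.eta j * S.E l (S.g j m) := by
        simp only [S.lower_hCoeff, del, mul_sub, Finset.sum_sub_distrib, Finset.mul_sum]
        rw [Finset.sum_comm]
        congr 1
        exact Finset.sum_congr rfl fun _ _ => Finset.sum_congr rfl fun _ _ => by ring
    _ = S.D k (S.Eb m S.L) := by
        simp only [S.sum_eta_E_g, mul_zero, Finset.sum_const_zero, sub_zero]
        rw [← S.sum_eta_g]
        simp [S.D_eta]

theorem vCoeff_symm (i j k : Fin n) : S.vCoeff i j k = S.vCoeff i k j := by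
  simp only [vCoeff, S.E_g_symm k j]

theorem sum_eta_vCoeff (i k : Fin n) : ∑ j, S.eta j * S.vCoeff i j k = 0 := by
  calc ∑ j, S.eta j * S.vCoeff i j k
      = ∑ l, S.gi l i * ∑ j, S.eta j * S.E k (S.g j l) := by
        simp only [vCoeff, Finset.mul_sum]
        rw [Finset.sum_comm]
        exact Finset.sum_congr rfl fun _ _ => Finset.sum_congr rfl fun _ _ => by ring
    _ = 0 := by simp [S.sum_eta_E_g]

theorem sum_EL_gi (l : Fin n) : ∑ i, S.gi l i * S.E i S.L = S.etab l := by
  calc ∑ i, S.gi l i * S.E i S.L = ∑ m, (∑ i, S.gi l i * S.g i m) * S.etab m := by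
        simp only [← S.sum_etab_g, Finset.mul_sum, Finset.sum_mul]
        rw [Finset.sum_comm]
        exact Finset.sum_congr rfl fun _ _ => Finset.sum_congr rfl fun _ _ => by ring
    _ = S.etab l := by simp [g, S.gi_g]

theorem sum_EL_vCoeff (j k : Fin n) :
    ∑ i, S.E i S.L * S.vCoeff i j k = S.E k (S.E j S.L) := by
  calc ∑ i, S.E i S.L * S.vCoeff i j k
      = ∑ l, (∑ i, S.gi l i * S.E i S.L) * S.E k (S.g j l) := by
        simp only [vCoeff, Finset.mul_sum, Finset.sum_mul]
        rw [Finset.sum_comm]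
        exact Finset.sum_congr rfl fun _ _ => Finset.sum_congr rfl fun _ _ => by ring
    _ = S.E k (S.E j S.L) := by
        simp only [S.sum_EL_gi]
        rw [← S.sum_etab_g j]
        simp [S.E_etab]

theorem E_delBar (j h : Fin n) (x : A) :
    S.E j (S.delBar h x) = S.delBar h (S.E j x) - ∑ l, S.E j (S.Nb l h) * S.Eb l x := by
  simp only [delBar, map_sub, map_sum, Derivation.leibniz, smul_eq_mul, S.E_Db, S.E_Eb,
    Finset.sum_add_distrib, mul_comm (S.Eb _ x)]
  ring

/-! ### Consequences of the curvature equation: fibre derivatives of the scalar and of the metric.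
-/

section Curvature

variable {S} {K : A}
  (hR : ∀ r j h k, S.Riem r j h k = K * (S.g j r * S.g k h + S.g k r * S.g j h))
include hR

theorem hCurv_eq (i j h k : Fin n) :
    S.hCurv i j h k = K * ((if i = j then S.g k h else 0) + (if i = k then S.g j h else 0)) := by
  refine congrFun (S.eq_of_lower (x := fun i => S.hCurv i j h k)
    (y := fun i => K * ((if i = j then S.g k h else 0) + (if i = k then S.g j h else 0)))
    fun m => ?_) i
  rw [show ∑ l, S.g l m * S.hCurv l j h k = S.Riem m j h k from rfl, hR]
  simp only [mul_add, Finset.sum_add_distrib, mul_ite, mul_zero, Finset.sum_ite_eq',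
    Finset.mem_univ, if_true]
  ring

/-- Contract the curvature with ηʲ: its vertical term drops out by homogeneity, and ηʲ passes
through δ_h̄, turning the horizontal coefficients into the nonlinear connection. -/
theorem delBar_N (i h k : Fin n) :
    S.delBar h (S.N i k) =
      -(K * (S.eta i * S.g k h + if i = k then S.Eb h S.L else 0)) := by
  have h1 : ∑ j, S.eta j * S.hCurv i j h k =
      K * (S.eta i * S.g k h + if i = k then S.Eb h S.L else 0) := by
    simp only [hCurv_eq hR, mul_add, Finset.sum_add_distrib, mul_ite, mul_zero,
      Finset.sum_ite_eq, Finset.mem_univ, if_true]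
    split_ifs with hik
    · rw [← S.sum_eta_g, Finset.mul_sum]
      congr 1
      · ring
      · exact Finset.sum_congr rfl fun _ _ => by ring
    · simp; ring
  have h2 : ∑ j, S.eta j * S.hCurv i j h k = -S.delBar h (S.N i k) := by
    conv_rhs => rw [← S.sum_eta_hCoeff]
    simp only [hCurv, mul_sub, Finset.sum_sub_distrib, S.delBar_sum, S.delBar_mul, S.delBar_eta,
      mul_zero, add_zero, mul_neg, Finset.sum_neg_distrib]
    rw [sub_eq_self]
    calc ∑ j, S.eta j * ∑ l, S.delBar h (S.N l k) * S.vCoeff i j l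
        = ∑ l, S.delBar h (S.N l k) * ∑ j, S.eta j * S.vCoeff i j l := by
          simp only [Finset.mul_sum]
          rw [Finset.sum_comm]
          exact Finset.sum_congr rfl fun _ _ => Finset.sum_congr rfl fun _ _ => by ring
      _ = 0 := by simp [S.sum_eta_vCoeff]
  rw [← h1, h2, neg_neg]

/-- Insert `delBar_N` into the definition of the curvature: the part proportional to ηˡ is killed by
the vertical coefficients, and only the Kronecker part survives. -/
theorem delBar_hCoeff (i j h k : Fin n) :
    S.delBar h (S.hCoeff i j k) =
      -(K * ((if i = j then S.g k h else 0) + (if i = k then S.g j h else 0)))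
        + K * (S.Eb h S.L * S.vCoeff i j k) := by
  have h1 := hCurv_eq hR i j h k
  have h2 : ∑ l, S.delBar h (S.N l k) * S.vCoeff i j l =
      -(K * (S.Eb h S.L * S.vCoeff i j k)) := by
    have : ∀ l, S.delBar h (S.N l k) * S.vCoeff i j l =
        -(K * S.g k h) * (S.eta l * S.vCoeff i l j)
          - if l = k then K * (S.Eb h S.L * S.vCoeff i j l) else 0 := by
      intro l
      rw [delBar_N hR, S.vCoeff_symm i l j]
      split_ifs <;> ring
    simp only [this, Finset.sum_sub_distrib, ← Finset.mul_sum, S.sum_eta_vCoeff]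
    simp
  rw [hCurv, h2] at h1
  linear_combination -h1

/-- Compare two evaluations of ∂/∂ηʲ δ_h̄ Nⁱ_k after contraction with L_i: directly from `delBar_N`,
and by commuting the derivatives and using `delBar_hCoeff`. -/
theorem curvature_identity (j k h : Fin n) :
    S.E j K * (S.L * S.g k h + S.E k S.L * S.Eb h S.L)
      + K * (S.L * S.E j (S.g k h) + S.Eb h S.L * S.E k (S.E j S.L)) = 0 := by
  have h1 : ∑ i, S.E i S.L * S.E j (S.delBar h (S.N i k)) =
      ∑ i, S.E i S.L * S.delBar h (S.hCoeff i j k) := by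
    simp only [S.E_delBar, S.E_N, mul_sub, Finset.sum_sub_distrib]
    rw [sub_eq_self]
    calc ∑ i, S.E i S.L * ∑ l, S.E j (S.Nb l h) * S.Eb l (S.N i k)
        = ∑ l, S.E j (S.Nb l h) * ∑ i, S.E i S.L * S.Eb l (S.N i k) := by
          simp only [Finset.mul_sum]
          rw [Finset.sum_comm]
          exact Finset.sum_congr rfl fun _ _ => Finset.sum_congr rfl fun _ _ => by ring
      _ = 0 := by simp [S.sum_EL_Eb_N]
  have h2 : ∑ i, S.E i S.L * S.delBar h (S.hCoeff i j k) =
      -(K * (S.E j S.L * S.g k h + S.E k S.L * S.g j h))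
        + K * (S.Eb h S.L * S.E k (S.E j S.L)) := by
    rw [← S.sum_EL_vCoeff]
    simp only [delBar_hCoeff hR, mul_add, mul_neg, Finset.sum_add_distrib,
      Finset.sum_neg_distrib, mul_ite, mul_zero, Finset.sum_ite_eq', Finset.mem_univ, if_true,
      Finset.mul_sum]
    have : ∀ i, S.E i S.L * (K * (S.Eb h S.L * S.vCoeff i j k)) =
      K * (S.Eb h S.L * (S.E i S.L * S.vCoeff i j k)) := fun i => by ring
    simp only [this]
    ring
  have h3 : ∑ i, S.E i S.L * S.E j (S.delBar h (S.N i k)) =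
      -(S.E j K * (S.L * S.g k h + S.E k S.L * S.Eb h S.L)
        + K * (S.E j S.L * S.g k h + S.L * S.E j (S.g k h) + S.E k S.L * S.g j h)) := by
    have : ∀ i, S.E i S.L * S.E j (S.delBar h (S.N i k)) =
        (-(S.E j K * S.g k h) - K * S.E j (S.g k h)) * (S.eta i * S.E i S.L)
          - (if j = i then K * S.g k h * S.E i S.L else 0)
          - if i = k then S.E i S.L * (S.E j K * S.Eb h S.L + K * S.g j h) else 0 := by
      intro i
      rw [delBar_N hR]
      simp only [map_neg, Derivation.leibniz, smul_eq_mul, map_add, S.E_eta]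
      split_ifs <;> simp [g] <;> ring
    simp only [this, Finset.sum_sub_distrib, ← Finset.mul_sum, S.euler]
    simp
    ring
  rw [h2, h3] at h1
  linear_combination -h1

theorem E_scalar_curvature (j : Fin n) : S.E j K = 0 := by
  -- L_j has degree 0 in η, by differentiating Euler's identity.
  have hE2 : ∀ k, ∑ j, S.eta j * S.E k (S.E j S.L) = 0 := by
    intro k
    have h := congrArg (S.E k) S.euler
    simp only [map_sum, Derivation.leibniz, smul_eq_mul, S.E_eta, Finset.sum_add_distrib] at h
    simpa using h
  have two : ∀ x : A, 2 * x = 0 → x = 0 := by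
    intro x hx
    have h2 : (2 : ℂ) • x = 0 := by rw [← hx, two_smul, two_mul]
    simpa using h2
  -- contraction with the conjugate fibre coordinates
  have hc : ∀ j k, S.E j K * S.E k S.L + K * S.E k (S.E j S.L) = 0 := by
    intro j k
    refine two _ (S.L_cancel _ ?_)
    have h : ∑ h, S.etab h * (S.E j K * (S.L * S.g k h + S.E k S.L * S.Eb h S.L)
      + K * (S.L * S.E j (S.g k h) + S.Eb h S.L * S.E k (S.E j S.L))) = 0 := by
      simp [curvature_identity hR]
    have h' : ∀ h, S.etab h * (S.E j K * (S.L * S.g k h + S.E k S.L * S.Eb h S.L)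
      + K * (S.L * S.E j (S.g k h) + S.Eb h S.L * S.E k (S.E j S.L))) =
        (S.E j K * S.L) * (S.etab h * S.g k h)
        + (S.E j K * S.E k S.L + K * S.E k (S.E j S.L)) * (S.etab h * S.Eb h S.L)
        + (K * S.L) * S.E j (S.etab h * S.g k h) := by
      intro h
      simp [S.E_etab]; ring
    simp only [h', Finset.sum_add_distrib, ← Finset.mul_sum, S.euler_bar, S.sum_etab_g,
      ← map_sum] at h
    rw [S.E_E j k] at h
    linear_combination h
  -- Contraction with ηʲ removes the Hessian term, so the radial derivative of K vanishes.
  have hs : ∀ k, (∑ j, S.eta j * S.E j K) * S.E k S.L = 0 := by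
    intro k
    calc (∑ j, S.eta j * S.E j K) * S.E k S.L
        = ∑ j, S.eta j * (S.E j K * S.E k S.L + K * S.E k (S.E j S.L))
          - K * ∑ j, S.eta j * S.E k (S.E j S.L) := by
          rw [Finset.mul_sum, Finset.sum_mul, ← Finset.sum_sub_distrib]
          exact Finset.sum_congr rfl fun _ _ => by ring
      _ = 0 := by simp [hc, hE2]
  have h0 : ∑ j, S.eta j * S.E j K = 0 := by
    refine S.L_cancel _ ?_
    conv_lhs => enter [1]; rw [← S.euler]
    rw [Finset.sum_mul]
    refine Finset.sum_eq_zero fun k _ => ?_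
    linear_combination S.eta k * hs k
  refine S.L_cancel _ ?_
  -- Antisymmetrizing in j, k removes the Hessian term as well; contracting with ηᵏ then reduces to
  -- the radial derivative.
  have hsym : ∀ k, S.E j K * S.E k S.L = S.E k K * S.E j S.L := by
    intro k
    have h1 := hc j k
    have h2 := hc k j
    rw [S.E_E] at h1
    linear_combination h1 - h2
  calc S.L * S.E j K = ∑ k, S.eta k * (S.E j K * S.E k S.L) := by
        conv_lhs => enter [1]; rw [← S.euler]
        rw [Finset.sum_mul]
        exact Finset.sum_congr rfl fun _ _ => by ring
    _ = (∑ k, S.eta k * S.E k K) * S.E j S.L := by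
        rw [Finset.sum_mul]
        exact Finset.sum_congr rfl fun k _ => by rw [hsym k]; ring
    _ = 0 := by rw [h0, zero_mul]

/-- With ∂K/∂ηʲ = 0 only the second half of `curvature_identity` remains. Its contraction with η̄ʰ
kills K L_jk, leaving K L ∂g_{kh̄}/∂ηʲ = 0. -/
theorem scalar_curvature_mul_E_g (j k h : Fin n) : K * S.E j (S.g k h) = 0 := by
  have hK := E_scalar_curvature hR
  have h1 := curvature_identity hR
  have h2 : K * S.E k (S.E j S.L) = 0 := by
    have two : ∀ x : A, 2 * x = 0 → x = 0 := by
      intro x hx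
      have h2 : (2 : ℂ) • x = 0 := by rw [← hx, two_smul, two_mul]
      simpa using h2
    refine two _ (S.L_cancel _ ?_)
    have h : ∑ h, S.etab h * (K * (S.L * S.E j (S.g k h) + S.Eb h S.L * S.E k (S.E j S.L))) = 0 :=
      Finset.sum_eq_zero fun h _ => by
        have := h1 j k h
        rw [hK, zero_mul, zero_add] at this
        rw [this, mul_zero]
    have h' : ∀ h, S.etab h * (K * (S.L * S.E j (S.g k h) + S.Eb h S.L * S.E k (S.E j S.L))) =
        (K * S.L) * S.E j (S.etab h * S.g k h)
          + (K * S.E k (S.E j S.L)) * (S.etab h * S.Eb h S.L) := by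
      intro h
      simp [S.E_etab]; ring
    simp only [h', Finset.sum_add_distrib, ← Finset.mul_sum, S.euler_bar, S.sum_etab_g,
      ← map_sum] at h
    rw [S.E_E j k] at h
    linear_combination h
  refine S.L_cancel _ ?_
  have := h1 j k h
  rw [hK, zero_mul, zero_add] at this
  linear_combination this - S.Eb h S.L * h2

end Curvature

/-! ### The Schur-type identity when the metric is independent of the fibre. -/

section Hermitian

variable {S} {K : A}
  (hR : ∀ r j h k, S.Riem r j h k = K * (S.g j r * S.g k h + S.g k r * S.g j h))
  (hE : ∀ k i j, S.E k (S.g i j) = 0) (hEb : ∀ k i j, S.Eb k (S.g i j) = 0)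

/-- `∑ gⁱʲ ∂ₖ gⱼᵢ`, the logarithmic derivative of the determinant of the fundamental tensor. -/
def traceConn (k : Fin n) : A := ∑ i, ∑ l, S.gi l i * S.D k (S.g i l)

/-- Second derivatives of log det g commute: the quadratic term is tr(G⁻¹ ∂_m G G⁻¹ ∂_k G),
symmetric by cyclicity of the trace. -/
theorem D_traceConn_symm (m k : Fin n) :
    S.D m (S.traceConn k) = S.D k (S.traceConn m) := by
  have key : ∀ m k, S.D m (S.traceConn k) =
      ∑ i, ∑ l, S.gi l i * S.D m (S.D k (S.g i l))
        - ∑ i, ∑ l, ∑ a, ∑ b, S.gi l a * S.D m (S.g a b) * S.gi b i * S.D k (S.g i l) := by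
    intro m k
    have hD : ∀ i l, S.D m (S.gi l i * S.D k (S.g i l)) = S.gi l i * S.D m (S.D k (S.g i l))
        - ∑ a, ∑ b, S.gi l a * S.D m (S.g a b) * S.gi b i * S.D k (S.g i l) := by
      intro i l
      rw [Derivation.leibniz, smul_eq_mul, smul_eq_mul,
        derivation_inverse (S.D m) S.g_gi S.gi_g]
      simp only [← Finset.sum_mul, g]
      ring
    simp only [traceConn, map_sum, hD, Finset.sum_sub_distrib]
  rw [key m k, key k m]
  congr 1
  · exact Finset.sum_congr rfl fun _ _ => Finset.sum_congr rfl fun _ _ => by rw [S.D_D]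
  · have hswap : ∀ f : Fin n → Fin n → Fin n → Fin n → A,
        ∑ i, ∑ l, ∑ a, ∑ b, f i l a b = ∑ i, ∑ l, ∑ a, ∑ b, f a b i l := by
      intro f
      have h := Finset.sum_comm (s := (Finset.univ : Finset (Fin n × Fin n)))
        (t := (Finset.univ : Finset (Fin n × Fin n))) (f := fun p q => f p.1 p.2 q.1 q.2)
      simpa only [Fintype.sum_prod_type] using h
    rw [hswap]
    refine Finset.sum_congr rfl fun _ _ => Finset.sum_congr rfl fun _ _ =>
      Finset.sum_congr rfl fun _ _ => Finset.sum_congr rfl fun _ _ => ?_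
    ring

include hE in
theorem hCoeff_eq_of_hermitian (i j k : Fin n) :
    S.hCoeff i j k = ∑ l, S.gi l i * S.D k (S.g j l) := by
  simp [hCoeff, del, hE]

include hR hE hEb in
-- The trace of the curvature over its endomorphism indices is the Ricci tensor; the two Kronecker
-- terms contribute n and 1.
theorem Db_traceConn (h k : Fin n) :
    S.Db h (S.traceConn k) = -((n + 1 : A) * (K * S.g k h)) := by
  have hv : ∀ i j k, S.vCoeff i j k = 0 := fun i j k => by simp [vCoeff, hE]
  have hEbgi : ∀ k a b, S.Eb k (S.gi a b) = 0 := by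
    intro k a b
    rw [derivation_inverse (S.Eb k) S.g_gi S.gi_g]
    refine neg_eq_zero.2 (Finset.sum_eq_zero fun l _ => Finset.sum_eq_zero fun m _ => ?_)
    rw [show S.E l (S.Eb m S.L) = S.g l m from rfl, hEb, mul_zero, zero_mul]
  have hd : ∀ i j k, S.delBar h (S.hCoeff i j k) = S.Db h (S.hCoeff i j k) := by
    intro i j k
    rw [delBar, sub_eq_self]
    refine Finset.sum_eq_zero fun l _ => ?_
    rw [hCoeff_eq_of_hermitian hE]
    simp [hEbgi, S.Eb_D, hEb]
  have ht : S.traceConn k = ∑ i, S.hCoeff i i k := by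
    simp only [hCoeff_eq_of_hermitian hE, traceConn]
  rw [ht, map_sum]
  simp only [← hd, delBar_hCoeff hR, hv, mul_zero, add_zero, if_true, mul_add, mul_ite,
    Finset.sum_add_distrib, Finset.sum_neg_distrib, Finset.sum_ite_eq', Finset.mem_univ]
  simp
  ring

include hR hE hEb in
/-- Schur-type identity: the `z`-derivative of the curvature is `K` times the torsion. -/
theorem D_scalar_curvature {m k : Fin n} (hmk : m ≠ k) :
    S.D m K = K * ∑ h, S.gi h k * (S.D k (S.g m h) - S.D m (S.g k h)) := by
  -- Commuting third derivatives of log det g make ∂_m(K g_{kh̄}) symmetric in m, k; the factor n +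
  -- 1 is invertible.
  have h1 : ∀ h, S.D m (K * S.g k h) = S.D k (K * S.g m h) := by
    intro h
    have h2 : S.Db h (S.D m (S.traceConn k)) = S.Db h (S.D k (S.traceConn m)) := by
      rw [S.D_traceConn_symm]
    rw [← S.D_Db, ← S.D_Db, Db_traceConn hR hE hEb, Db_traceConn hR hE hEb] at h2
    have hn : ((n : ℂ) + 1) ≠ 0 := by exact_mod_cast Nat.succ_ne_zero n
    have h3 : ∀ x : A, ((n : A) + 1) * x = ((n : ℂ) + 1) • x := by
      intro x; rw [Algebra.smul_def]; simp
    simp only [h3, map_neg, Derivation.map_smul, neg_inj] at h2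
    exact smul_right_injective A hn h2
  have h4 : ∀ h, S.D m K * S.g k h - S.D k K * S.g m h =
      K * (S.D k (S.g m h) - S.D m (S.g k h)) := by
    intro h
    have := h1 h
    simp only [Derivation.leibniz, smul_eq_mul] at this
    linear_combination this
  -- Raising h to the index k isolates ∂_m K, because m ≠ k removes the other derivative.
  calc S.D m K = S.D m K * (∑ h, S.g k h * S.gi h k) - S.D k K * ∑ h, S.g m h * S.gi h k := by
        simp [g, S.g_gi, hmk]
    _ = ∑ h, S.gi h k * (S.D m K * S.g k h - S.D k K * S.g m h) := by
        rw [Finset.mul_sum, Finset.mul_sum, ← Finset.sum_sub_distrib]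
        exact Finset.sum_congr rfl fun _ _ => by ring
    _ = _ := by
        simp only [h4, Finset.mul_sum]
        exact Finset.sum_congr rfl fun _ _ => by ring

end Hermitian

end FinslerAlgebra


/-! ### The algebra of smooth functions on an open set and its Wirtinger derivations. -/

section SmoothAlgebra

open TopologicalSpace

variable {V : Type*} [NormedAddCommGroup V] [NormedSpace ℂ V]

/-- The algebra of complex functions on the open set `S` that are smooth in the real sense. -/
def smoothFun (S : Opens V) : Subalgebra ℂ (S → ℂ) where
  carrier := {f | ∃ F : V → ℂ, ContDiffOn ℝ ∞ F S ∧ ∀ x : S, F x = f x}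
  mul_mem' := by
    rintro f f' ⟨F, hF, h⟩ ⟨F', hF', h'⟩
    exact ⟨fun x => F x * F' x, hF.mul hF', fun x => by simp [h, h']⟩
  add_mem' := by
    rintro f f' ⟨F, hF, h⟩ ⟨F', hF', h'⟩
    exact ⟨fun x => F x + F' x, hF.add hF', fun x => by simp [h, h']⟩
  algebraMap_mem' c := ⟨fun _ => c, contDiffOn_const, fun _ => rfl⟩

/-- The ambient function `F` restricts to the element `a` of the algebra of smooth functions. -/
def Rep {S : Opens V} (a : smoothFun S) (F : V → ℂ) : Prop := ∀ x : S, F x = a.1 x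

variable {S : Opens V} {a b : smoothFun S} {F G : V → ℂ}

theorem Rep.contDiffOn (h : Rep a F) : ContDiffOn ℝ ∞ F S := by
  obtain ⟨G, hG, hGa⟩ := a.2
  exact hG.congr fun x hx => (h ⟨x, hx⟩).trans (hGa ⟨x, hx⟩).symm

theorem Rep.contDiffAt (h : Rep a F) (x : S) : ContDiffAt ℝ ∞ F x :=
  h.contDiffOn.contDiffAt (S.isOpen.mem_nhds x.2)

theorem Rep.differentiableAt (h : Rep a F) (x : S) : DifferentiableAt ℝ F x :=
  (h.contDiffAt x).differentiableAt (by simp)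

theorem exists_rep (a : smoothFun S) : ∃ F : V → ℂ, Rep a F :=
  let ⟨F, _, h⟩ := a.2; ⟨F, h⟩

theorem exists_of_contDiffOn (h : ContDiffOn ℝ ∞ F S) : ∃ a : smoothFun S, Rep a F :=
  ⟨⟨fun x => F x, F, h, fun _ => rfl⟩, fun _ => rfl⟩

theorem Rep.unique (h : Rep a F) (h' : Rep b F) : a = b :=
  Subtype.ext (funext fun x => (h x).symm.trans (h' x))

theorem Rep.congr (h : Rep a F) (h' : ∀ x ∈ S, G x = F x) : Rep a G :=
  fun x => (h' x x.2).trans (h x)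

theorem Rep.eventuallyEq (h : Rep a F) (h' : Rep a G) (x : S) : F =ᶠ[nhds (x : V)] G := by
  filter_upwards [S.isOpen.mem_nhds x.2] with y hy
  exact (h ⟨y, hy⟩).trans (h' ⟨y, hy⟩).symm

theorem Rep.add (h : Rep a F) (h' : Rep b G) : Rep (a + b) (fun x => F x + G x) :=
  fun x => congrArg₂ _ (h x) (h' x)

theorem Rep.sub (h : Rep a F) (h' : Rep b G) : Rep (a - b) (fun x => F x - G x) :=
  fun x => congrArg₂ _ (h x) (h' x)

theorem Rep.mul (h : Rep a F) (h' : Rep b G) : Rep (a * b) (fun x => F x * G x) :=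
  fun x => congrArg₂ _ (h x) (h' x)

theorem Rep.neg (h : Rep a F) : Rep (-a) (fun x => -F x) :=
  fun x => congrArg _ (h x)

theorem Rep.smul (c : ℂ) (h : Rep a F) : Rep (c • a) (fun x => c * F x) :=
  fun x => congrArg (c * ·) (h x)

theorem Rep.sum {ι : Type*} {s : Finset ι} {a : ι → smoothFun S} {F : ι → V → ℂ}
    (h : ∀ i, Rep (a i) (F i)) : Rep (∑ i ∈ s, a i) (fun x => ∑ i ∈ s, F i x) := by
  classical
  induction s using Finset.induction_on with
  | empty => intro x; simp
  | insert i s hi ih =>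
    simp only [Finset.sum_insert hi]
    exact (h i).add ih

theorem Rep.fderiv (h : Rep a F) (v : V) :
    ∃ b : smoothFun S, Rep b (fun x => fderiv ℝ F x v) :=
  exists_of_contDiffOn
    ((h.contDiffOn.fderiv_of_isOpen S.isOpen (by simp)).clm_apply contDiffOn_const)

/-- The real directional derivative of a smooth function. -/
def dirFun (v : V) (a : smoothFun S) : smoothFun S := ((exists_rep a).choose_spec.fderiv v).choose

/-- On an open set the derivative depends only on the germ, so the representative chosen in `dirFun`
is immaterial. -/
theorem Rep.dirFun (h : Rep a F) (v : V) :
    Rep (dirFun v a) (fun x => _root_.fderiv ℝ F x v) := fun x => by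
  refine Eq.trans ?_ (((exists_rep a).choose_spec.fderiv v).choose_spec x)
  simp only
  rw [(h.eventuallyEq (exists_rep a).choose_spec x).fderiv_eq]

/-- The real directional derivative, as a derivation of the algebra of smooth functions. -/
def dirDeriv (S : Opens V) (v : V) : Derivation ℂ (smoothFun S) (smoothFun S) :=
  Derivation.mk'
    { toFun := dirFun v
      map_add' := fun a b => by
        obtain ⟨F, hF⟩ := exists_rep a
        obtain ⟨G, hG⟩ := exists_rep b
        refine ((hF.add hG).dirFun v).unique (((hF.dirFun v).add (hG.dirFun v)).congr
          fun x hx => ?_)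
        rw [fderiv_fun_add (hF.differentiableAt ⟨x, hx⟩) (hG.differentiableAt ⟨x, hx⟩)]
        rfl
      map_smul' := fun c a => by
        obtain ⟨F, hF⟩ := exists_rep a
        refine ((hF.smul c).dirFun v).unique (((hF.dirFun v).smul c).congr fun x hx => ?_)
        rw [fderiv_const_mul (hF.differentiableAt ⟨x, hx⟩)]
        rfl }
    fun a b => by
      obtain ⟨F, hF⟩ := exists_rep a
      obtain ⟨G, hG⟩ := exists_rep b
      refine ((hF.mul hG).dirFun v).unique
        (((hF.mul (hG.dirFun v)).add (hG.mul (hF.dirFun v))).congr fun x hx => ?_)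
      rw [fderiv_fun_mul (hF.differentiableAt ⟨x, hx⟩) (hG.differentiableAt ⟨x, hx⟩)]
      rfl

theorem Rep.dirDeriv (h : Rep a F) (v : V) :
    Rep (dirDeriv S v a) (fun x => _root_.fderiv ℝ F x v) := h.dirFun v

theorem dirDeriv_comm (v w : V) (a : smoothFun S) :
    dirDeriv S v (dirDeriv S w a) = dirDeriv S w (dirDeriv S v a) := by
  obtain ⟨F, hF⟩ := exists_rep a
  have key : ∀ (v w : V) (x : S), (dirDeriv S v (dirDeriv S w a)).1 x =
      fderiv ℝ (fderiv ℝ F) x v w := by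
    intro v w x
    have hd : DifferentiableAt ℝ (fderiv ℝ F) x :=
      ((hF.contDiffAt x).fderiv_right (m := 1) (by norm_cast)).differentiableAt (by simp)
    rw [← ((hF.dirDeriv w).dirDeriv v) x]
    simp only
    rw [fderiv_clm_apply hd (differentiableAt_const w)]
    simp
  refine Subtype.ext (funext fun x => ?_)
  rw [key, key]
  refine (ContDiffAt.isSymmSndFDerivAt (n := ∞) (hF.contDiffAt x) ?_).eq v w
  simp only [minSmoothness_of_isRCLikeNormedField]
  norm_cast

/-- The `(1,0)` derivative in the direction `v`. -/
def wirtD (S : Opens V) (v : V) : Derivation ℂ (smoothFun S) (smoothFun S) :=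
  (1 / 2 : ℂ) • (dirDeriv S v - Complex.I • dirDeriv S (Complex.I • v))

/-- The `(0,1)` derivative in the direction `v`. -/
def wirtBarD (S : Opens V) (v : V) : Derivation ℂ (smoothFun S) (smoothFun S) :=
  (1 / 2 : ℂ) • (dirDeriv S v + Complex.I • dirDeriv S (Complex.I • v))

theorem Rep.wirt (h : Rep a F) (v : V) : Rep (wirtD S v a) (wirt F v) :=
  ((h.dirDeriv v).sub ((h.dirDeriv (Complex.I • v)).smul Complex.I)).smul (1 / 2 : ℂ)

theorem Rep.wirtBar (h : Rep a F) (v : V) : Rep (wirtBarD S v a) (wirtBar F v) :=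
  ((h.dirDeriv v).add ((h.dirDeriv (Complex.I • v)).smul Complex.I)).smul (1 / 2 : ℂ)

theorem wirtD_comm (v w : V) (a : smoothFun S) :
    wirtD S v (wirtD S w a) = wirtD S w (wirtD S v a) := by
  simp only [wirtD, Derivation.smul_apply, Derivation.sub_apply, Derivation.map_smul, map_sub,
    dirDeriv_comm v, dirDeriv_comm (Complex.I • v)]
  module

theorem wirtD_wirtBarD_comm (v w : V) (a : smoothFun S) :
    wirtD S v (wirtBarD S w a) = wirtBarD S w (wirtD S v a) := by
  simp only [wirtD, wirtBarD, Derivation.smul_apply, Derivation.sub_apply, Derivation.map_smul,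
    map_sub, map_add, Derivation.add_apply, dirDeriv_comm v, dirDeriv_comm (Complex.I • v)]
  module

/-- Complex conjugation on the algebra of smooth functions. -/
def conjFun (a : smoothFun S) : smoothFun S :=
  ⟨fun x => conj (a.1 x), by
    obtain ⟨F, hF⟩ := exists_rep a
    exact ⟨fun x => conj (F x), Complex.conjCLE.contDiff.comp_contDiffOn hF.contDiffOn,
      fun x => congrArg conj (hF x)⟩⟩

theorem Rep.conj (h : Rep a F) : Rep (conjFun a) (fun x => conj (F x)) :=
  fun x => congrArg _ (h x)

theorem conjFun_add (a b : smoothFun S) : conjFun (a + b) = conjFun a + conjFun b :=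
  Subtype.ext (funext fun _ => map_add (starRingEnd ℂ) _ _)

theorem conjFun_sub (a b : smoothFun S) : conjFun (a - b) = conjFun a - conjFun b :=
  Subtype.ext (funext fun _ => map_sub (starRingEnd ℂ) _ _)

theorem conjFun_mul (a b : smoothFun S) : conjFun (a * b) = conjFun a * conjFun b :=
  Subtype.ext (funext fun _ => map_mul (starRingEnd ℂ) _ _)

theorem conjFun_smul (c : ℂ) (a : smoothFun S) : conjFun (c • a) = conj c • conjFun a :=
  Subtype.ext (funext fun _ => map_mul (starRingEnd ℂ) _ _)

theorem conjFun_conjFun (a : smoothFun S) : conjFun (conjFun a) = a :=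
  Subtype.ext (funext fun _ => Complex.conj_conj _)

theorem conjFun_zero : conjFun (0 : smoothFun S) = 0 :=
  Subtype.ext (funext fun _ => map_zero (starRingEnd ℂ))

theorem conjFun_sum {ι : Type*} (s : Finset ι) (f : ι → smoothFun S) :
    conjFun (∑ i ∈ s, f i) = ∑ i ∈ s, conjFun (f i) := by
  classical
  induction s using Finset.induction_on with
  | empty => simp [conjFun_zero]
  | insert i s hi ih => simp only [Finset.sum_insert hi, conjFun_add, ih]

theorem conjFun_dirDeriv (v : V) (a : smoothFun S) :
    conjFun (dirDeriv S v a) = dirDeriv S v (conjFun a) := by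
  obtain ⟨F, hF⟩ := exists_rep a
  refine (hF.dirDeriv v).conj.unique ((hF.conj.dirDeriv v).congr fun x hx => ?_)
  have h := (Complex.conjCLE.toContinuousLinearMap.hasFDerivAt.comp (x : V)
    (hF.differentiableAt ⟨x, hx⟩).hasFDerivAt).fderiv
  exact (DFunLike.congr_fun h v).symm

theorem conjFun_wirtD (v : V) (a : smoothFun S) :
    conjFun (wirtD S v a) = wirtBarD S v (conjFun a) := by
  simp only [wirtD, wirtBarD, Derivation.smul_apply, Derivation.sub_apply, Derivation.add_apply,
    conjFun_smul, conjFun_sub, conjFun_dirDeriv, map_div₀, map_one, Complex.conj_ofNat,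
    Complex.conj_I, neg_smul, sub_neg_eq_add]

theorem conjFun_wirtBarD (v : V) (a : smoothFun S) :
    conjFun (wirtBarD S v a) = wirtD S v (conjFun a) := by
  rw [← conjFun_conjFun (wirtD S v (conjFun a)), conjFun_wirtD, conjFun_conjFun]

/-- Turns pointwise nonvanishing of L, det g or the curvature into cancellation in the algebra. -/
theorem isUnit_smoothFun (h : ∀ x : S, a.1 x ≠ 0) : IsUnit a := by
  obtain ⟨F, hF⟩ := exists_rep a
  obtain ⟨b, hb⟩ := exists_of_contDiffOn (S := S) (F := fun x => (F x)⁻¹)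
    (hF.contDiffOn.inv fun x hx => by rw [hF ⟨x, hx⟩]; exact h _)
  refine IsUnit.of_mul_eq_one b (Subtype.ext (funext fun x => ?_))
  change a.1 x * b.1 x = 1
  rw [← hb x]
  simp only
  rw [hF x, mul_inv_cancel₀ (h x)]

end SmoothAlgebra


open TopologicalSpace

/-! ### Local Lagrangians as instances of the abstract calculus. -/

variable {n : ℕ} {S : Opens (Cn n × Cn n)} {L : Cn n × Cn n → ℂ}

/-- The local properties of a complex Finsler Lagrangian used by the connection calculus. -/
structure IsLocalLagrangian (S : Opens (Cn n × Cn n)) (L : Cn n × Cn n → ℂ) : Prop where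
  smooth : ContDiffOn ℝ ∞ L S
  real : ∀ u ∈ S, conj (L u) = L u
  euler : ∀ u ∈ S, ∑ i, u.2 i * dEta i L u = L u
  ne_zero : ∀ u ∈ S, L u ≠ 0
  det_ne_zero : ∀ u ∈ S, (gMatrix L u).det ≠ 0

theorem IsLocalLagrangian.mono {T : Opens (Cn n × Cn n)} (h : IsLocalLagrangian S L)
    (hT : T ≤ S) : IsLocalLagrangian T L where
  smooth := h.smooth.mono hT
  real u hu := h.real u (hT hu)
  euler u hu := h.euler u (hT hu)
  ne_zero u hu := h.ne_zero u (hT hu)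
  det_ne_zero u hu := h.det_ne_zero u (hT hu)

/-- The fibre coordinate as a smooth function. -/
def etaFun (S : Opens (Cn n × Cn n)) (i : Fin n) : smoothFun S :=
  ⟨fun u => u.1.2 i, fun u => u.2 i,
    (((ContinuousLinearMap.proj (R := ℝ) (φ := fun _ : Fin n => ℂ) i).comp
      (ContinuousLinearMap.snd ℝ (Cn n) (Cn n))).contDiff).contDiffOn, fun _ => rfl⟩

theorem rep_etaFun (i : Fin n) : Rep (etaFun S i) (fun u => u.2 i) := fun _ => rfl

theorem fderiv_snd_apply (i : Fin n) (u v : Cn n × Cn n) :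
    fderiv ℝ (fun u : Cn n × Cn n => u.2 i) u v = v.2 i :=
  DFunLike.congr_fun (((ContinuousLinearMap.proj (R := ℝ) (φ := fun _ : Fin n => ℂ) i).comp
      (ContinuousLinearMap.snd ℝ (Cn n) (Cn n))).fderiv (x := u)) v

theorem wirtD_etaFun (v : Cn n × Cn n) (i : Fin n) :
    wirtD S v (etaFun S i) = algebraMap ℂ _ (v.2 i) := by
  refine ((rep_etaFun i).wirt v).unique fun x => ?_
  rw [wirt, fderiv_snd_apply, fderiv_snd_apply]
  change _ = v.2 i
  simp only [Prod.smul_snd, Pi.smul_apply, smul_eq_mul]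
  linear_combination (-1 / 2 * v.2 i) * Complex.I_mul_I

theorem wirtBarD_etaFun (v : Cn n × Cn n) (i : Fin n) :
    wirtBarD S v (etaFun S i) = 0 := by
  refine ((rep_etaFun i).wirtBar v).unique fun x => ?_
  rw [wirtBar, fderiv_snd_apply, fderiv_snd_apply]
  change _ = (0 : ℂ)
  simp only [Prod.smul_snd, Pi.smul_apply, smul_eq_mul]
  linear_combination (1 / 2 * v.2 i) * Complex.I_mul_I

theorem wirtD_conj_etaFun (v : Cn n × Cn n) (i : Fin n) :
    wirtD S v (conjFun (etaFun S i)) = 0 := by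
  rw [← conjFun_wirtBarD, wirtBarD_etaFun, conjFun_zero]

namespace IsLocalLagrangian

variable (h : IsLocalLagrangian S L)
include h

/-- The Lagrangian as a smooth function. -/
def lagr : smoothFun S := ⟨fun u => L u, L, h.smooth, fun _ => rfl⟩

theorem rep_lagr : Rep h.lagr L := fun _ => rfl

theorem conj_lagr : conjFun h.lagr = h.lagr :=
  Subtype.ext (funext fun x => h.real x x.2)

/-- The matrix of the fundamental tensor over the algebra of smooth functions. -/
def gMat : Matrix (Fin n) (Fin n) (smoothFun S) :=
  Matrix.of fun i j =>
    wirtD S (0, Pi.single i 1) (wirtBarD S (0, Pi.single j 1) h.lagr)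

theorem rep_gMat (i j : Fin n) : Rep (h.gMat i j) (g L i j) :=
  (h.rep_lagr.wirtBar _).wirt _

theorem gMat_map (x : S) :
    ((Pi.evalRingHom (fun _ : S => ℂ) x).comp (smoothFun S).val.toRingHom).mapMatrix h.gMat =
      gMatrix L x := by
  ext i j
  exact (h.rep_gMat i j x).symm

theorem isUnit_det_gMat : IsUnit h.gMat.det := by
  refine isUnit_smoothFun fun x => ?_
  have h1 := h.det_ne_zero x x.2
  rw [← h.gMat_map, ← RingHom.map_det] at h1
  exact h1

/-- Evaluation at a point is a ring homomorphism, so it carries the inverse over the algebra to the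
pointwise inverse. -/
theorem rep_gMat_inv (i j : Fin n) : Rep (h.gMat⁻¹ i j) (gInv L i j) := by
  intro x
  have h1 := congrArg
    ((Pi.evalRingHom (fun _ : S => ℂ) x).comp (smoothFun S).val.toRingHom).mapMatrix
    (h.gMat.mul_nonsing_inv h.isUnit_det_gMat)
  rw [map_mul, map_one, h.gMat_map] at h1
  rw [gInv, Matrix.inv_eq_right_inv h1]
  rfl

/-- The Chern–Finsler data of a local Lagrangian. -/
def finslerAlgebra : FinslerAlgebra n (smoothFun S) where
  D k := wirtD S (Pi.single k 1, 0)
  Db k := wirtBarD S (Pi.single k 1, 0)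
  E k := wirtD S (0, Pi.single k 1)
  Eb k := wirtBarD S (0, Pi.single k 1)
  D_D _ _ _ := wirtD_comm _ _ _
  D_Db _ _ _ := wirtD_wirtBarD_comm _ _ _
  E_E _ _ _ := wirtD_comm _ _ _
  E_Eb _ _ _ := wirtD_wirtBarD_comm _ _ _
  E_D _ _ _ := wirtD_comm _ _ _
  E_Db _ _ _ := wirtD_wirtBarD_comm _ _ _
  Eb_D _ _ _ := (wirtD_wirtBarD_comm _ _ _).symm
  eta := etaFun S
  etab i := conjFun (etaFun S i)
  E_eta i j := by
    rw [wirtD_etaFun]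
    simp only [Pi.single_apply, eq_comm (a := j)]
    split_ifs <;> simp
  Eb_eta _ _ := wirtBarD_etaFun _ _
  D_eta _ _ := by simp [wirtD_etaFun]
  Db_eta _ _ := wirtBarD_etaFun _ _
  E_etab _ _ := wirtD_conj_etaFun _ _
  D_etab _ _ := wirtD_conj_etaFun _ _
  L := h.lagr
  euler := by
    refine Rep.unique (Rep.sum fun i => (rep_etaFun i).mul (h.rep_lagr.wirt _)) fun x => ?_
    exact h.euler x x.2
  euler_bar := by
    have h1 : ∑ i, etaFun S i * wirtD S (0, Pi.single i 1) h.lagr = h.lagr := by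
      refine Rep.unique (Rep.sum fun i => (rep_etaFun i).mul (h.rep_lagr.wirt _)) fun x => ?_
      exact h.euler x x.2
    have h2 := congrArg conjFun h1
    simpa only [conjFun_sum, conjFun_mul, conjFun_wirtD, h.conj_lagr] using h2
  L_cancel x hx :=
    (isUnit_smoothFun (a := h.lagr) fun u => h.ne_zero u u.2).mul_right_eq_zero.1 hx
  gi i j := h.gMat⁻¹ i j
  g_gi l k := by
    have h1 := congrFun₂ (h.gMat.mul_nonsing_inv h.isUnit_det_gMat) l k
    rwa [Matrix.mul_apply, Matrix.one_apply] at h1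
  gi_g l k := by
    have h1 := congrFun₂ (h.gMat.nonsing_inv_mul h.isUnit_det_gMat) l k
    rwa [Matrix.mul_apply, Matrix.one_apply] at h1
  Nb k j := conjFun (∑ m, ∑ l, h.gMat⁻¹ m k * wirtD S (Pi.single j 1, 0) (h.gMat l m) *
    etaFun S l)

variable {a : smoothFun S} {f : Cn n × Cn n → ℂ}

theorem rep_g (i j : Fin n) : Rep (h.finslerAlgebra.g i j) (g L i j) := h.rep_gMat i j

theorem rep_gi (i j : Fin n) : Rep (h.finslerAlgebra.gi i j) (gInv L i j) := h.rep_gMat_inv i j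

theorem rep_N (k j : Fin n) : Rep (h.finslerAlgebra.N k j) (N L k j) :=
  Rep.sum fun m => Rep.sum fun l =>
    ((h.rep_gi m k).mul ((h.rep_g l m).wirt _)).mul (rep_etaFun l)

theorem rep_Nb (k j : Fin n) : Rep (h.finslerAlgebra.Nb k j) (fun u => conj (N L k j u)) :=
  (h.rep_N k j).conj

theorem rep_del (ha : Rep a f) (k : Fin n) : Rep (h.finslerAlgebra.del k a) (del L k f) :=
  (ha.wirt _).sub (Rep.sum fun j => (h.rep_N j k).mul (ha.wirt _))

theorem rep_delBar (ha : Rep a f) (k : Fin n) :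
    Rep (h.finslerAlgebra.delBar k a) (delBar L k f) :=
  (ha.wirtBar _).sub (Rep.sum fun j => (h.rep_Nb j k).mul (ha.wirtBar _))

theorem rep_hCoeff (i j k : Fin n) : Rep (h.finslerAlgebra.hCoeff i j k) (hCoeff L i j k) :=
  Rep.sum fun l => (h.rep_gi l i).mul (h.rep_del (h.rep_g j l) k)

theorem rep_vCoeff (i j k : Fin n) : Rep (h.finslerAlgebra.vCoeff i j k) (vCoeff L i j k) :=
  Rep.sum fun l => (h.rep_gi l i).mul ((h.rep_g j l).wirt _)

theorem rep_hCurv (i j m k : Fin n) : Rep (h.finslerAlgebra.hCurv i j m k) (hCurv L i j m k) :=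
  (h.rep_delBar (h.rep_hCoeff i j k) m).neg.sub
    (Rep.sum fun l => (h.rep_delBar (h.rep_N l k) m).mul (h.rep_vCoeff i j l))

theorem rep_Riem (r j m k : Fin n) : Rep (h.finslerAlgebra.Riem r j m k) (Riem L r j m k) :=
  Rep.sum fun l => (h.rep_g l r).mul (h.rep_hCurv l j m k)

theorem conj_g (i j : Fin n) : conjFun (h.finslerAlgebra.g i j) = h.finslerAlgebra.g j i := by
  change conjFun (wirtD S _ (wirtBarD S _ h.lagr)) = wirtD S _ (wirtBarD S _ h.lagr)
  rw [conjFun_wirtD, conjFun_wirtBarD, h.conj_lagr, ← wirtD_wirtBarD_comm]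

variable {κ : Cn n × Cn n → ℂ}
  (hR : ∀ u ∈ S, ∀ r j m k, Riem L r j m k u = κ u * (g L j r u * g L k m u + g L k r u * g L j m u))
include hR

theorem algebra_curvature (ha : Rep a κ) (r j m k : Fin n) :
    h.finslerAlgebra.Riem r j m k = a * (h.finslerAlgebra.g j r * h.finslerAlgebra.g k m +
      h.finslerAlgebra.g k r * h.finslerAlgebra.g j m) :=
  (h.rep_Riem r j m k).unique
    ((ha.mul (((h.rep_g j r).mul (h.rep_g k m)).add ((h.rep_g k r).mul (h.rep_g j m)))).congr
      fun u hu => hR u hu r j m k)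

/-- Smoothness of the scalar is not a hypothesis: the component R_{īiīi} = 2κ g_{iī}² determines κ
as a quotient of smooth functions. -/
theorem contDiffOn_scalar_curvature (i : Fin n) (hi : ∀ u ∈ S, g L i i u ≠ 0) :
    ContDiffOn ℝ ∞ κ S := by
  have h1 : ContDiffOn ℝ ∞ (fun u => Riem L i i i i u * (2 * (g L i i u * g L i i u))⁻¹) S := by
    refine (h.rep_Riem i i i i).contDiffOn.mul (ContDiffOn.inv (contDiffOn_const.mul
      ((h.rep_g i i).contDiffOn.mul (h.rep_g i i).contDiffOn)) fun u hu => ?_)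
    have := hi u hu
    simp [this]
  refine h1.congr fun u hu => ?_
  have := hi u hu
  simp only [hR u hu]
  field_simp
  ring

theorem dEta_scalar_curvature (hκ : ContDiffOn ℝ ∞ κ S) {u : Cn n × Cn n} (hu : u ∈ S)
    (j : Fin n) : dEta j κ u = 0 := by
  obtain ⟨a, ha⟩ := exists_of_contDiffOn hκ
  have h1 := FinslerAlgebra.E_scalar_curvature (h.algebra_curvature hR ha) j
  exact (ha.wirt _ ⟨u, hu⟩).trans (congrFun (congrArg Subtype.val h1) ⟨u, hu⟩)

theorem g_hermitian_of_ne_zero (hκ : ContDiffOn ℝ ∞ κ S) (hκ0 : ∀ u ∈ S, κ u ≠ 0)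
    (j k m : Fin n) :
    h.finslerAlgebra.E j (h.finslerAlgebra.g k m) = 0 ∧
      h.finslerAlgebra.Eb j (h.finslerAlgebra.g k m) = 0 := by
  obtain ⟨a, ha⟩ := exists_of_contDiffOn hκ
  have hu : IsUnit a := isUnit_smoothFun fun u => by rw [← ha u]; exact hκ0 u u.2
  have hE : ∀ j k m, h.finslerAlgebra.E j (h.finslerAlgebra.g k m) = 0 := fun j k m =>
    hu.mul_right_eq_zero.1
      (FinslerAlgebra.scalar_curvature_mul_E_g (h.algebra_curvature hR ha) j k m)
  refine ⟨hE j k m, ?_⟩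
  have h1 := congrArg conjFun (hE j m k)
  rw [conjFun_zero] at h1
  rw [← h.conj_g m k, ← h1]
  exact (conjFun_wirtD _ _).symm

theorem dEta_dEtaBar_g_eq_zero (hκ : ContDiffOn ℝ ∞ κ S) (hκ0 : ∀ u ∈ S, κ u ≠ 0)
    {u : Cn n × Cn n} (hu : u ∈ S) (j k m : Fin n) :
    dEta j (g L k m) u = 0 ∧ dEtaBar j (g L k m) u = 0 := by
  obtain ⟨h1, h2⟩ := h.g_hermitian_of_ne_zero hR hκ hκ0 j k m
  exact ⟨((h.rep_g k m).wirt _ ⟨u, hu⟩).trans (congrFun (congrArg Subtype.val h1) ⟨u, hu⟩),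
    ((h.rep_g k m).wirtBar _ ⟨u, hu⟩).trans (congrFun (congrArg Subtype.val h2) ⟨u, hu⟩)⟩

theorem dz_scalar_curvature_of_ne_zero (hκ : ContDiffOn ℝ ∞ κ S) (hκ0 : ∀ u ∈ S, κ u ≠ 0)
    {u : Cn n × Cn n} (hu : u ∈ S) {m k : Fin n} (hmk : m ≠ k) :
    dz m κ u = κ u * ∑ l, gInv L l k u * (dz k (g L m l) u - dz m (g L k l) u) := by
  obtain ⟨a, ha⟩ := exists_of_contDiffOn hκ
  have h1 := FinslerAlgebra.D_scalar_curvature (h.algebra_curvature hR ha)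
    (fun j k m => (h.g_hermitian_of_ne_zero hR hκ hκ0 j k m).1)
    (fun j k m => (h.g_hermitian_of_ne_zero hR hκ hκ0 j k m).2) hmk
  exact (ha.wirt _ ⟨u, hu⟩).trans ((congrFun (congrArg Subtype.val h1) ⟨u, hu⟩).trans
    ((ha.mul (Rep.sum fun l => (h.rep_gi l k).mul (((h.rep_g m l).wirt _).sub
      ((h.rep_g k l).wirt _)))) ⟨u, hu⟩).symm)

omit hR in
theorem contDiffOn_torsion (m k : Fin n) : ContDiffOn ℝ ∞
    (fun u => ∑ l, gInv L l k u * (dz k (g L m l) u - dz m (g L k l) u)) S :=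
  Rep.contDiffOn (Rep.sum (s := Finset.univ) fun l => (h.rep_gi l k).mul
    (((h.rep_g m l).wirt _).sub ((h.rep_g k l).wirt _)))

/-- The Schur-type identity, in a form that holds at the zeros of the curvature as well. -/
theorem scalar_curvature_mul_dz (hκ : ContDiffOn ℝ ∞ κ S) {u : Cn n × Cn n} (hu : u ∈ S)
    {m k : Fin n} (hmk : m ≠ k) : κ u * dz m κ u =
      κ u ^ 2 * ∑ l, gInv L l k u * (dz k (g L m l) u - dz m (g L k l) u) := by
  by_cases h0 : κ u = 0
  · simp [h0]
  -- The metric is known to be Hermitian only where κ ≠ 0, so the identity is applied on that open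
  -- subset.
  let T : Opens (Cn n × Cn n) :=
    ⟨S ∩ κ ⁻¹' {0}ᶜ, hκ.continuousOn.isOpen_inter_preimage S.isOpen isOpen_compl_singleton⟩
  have hTS : T ≤ S := fun u hu => hu.1
  rw [(h.mono hTS).dz_scalar_curvature_of_ne_zero (fun u hu => hR u (hTS hu)) (hκ.mono hTS)
    (fun u hu => hu.2) (⟨hu, h0⟩ : u ∈ T) hmk]
  ring

end IsLocalLagrangian


open TopologicalSpace

/-! ### Real differentials in terms of Wirtinger derivatives, and constancy along fibres. -/

section WirtingerLinear

variable {V : Type*} [NormedAddCommGroup V] [NormedSpace ℂ V] (f : V → ℂ) (u : V)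

theorem fderiv_eq_wirt_add_wirtBar (v : V) :
    fderiv ℝ f u v = wirt f v u + wirtBar f v u := by
  rw [wirt, wirtBar]; ring

theorem fderiv_complex_smul (c : ℂ) (v : V) :
    fderiv ℝ f u (c • v) = c.re * fderiv ℝ f u v + c.im * fderiv ℝ f u (Complex.I • v) := by
  have h : c • v = c.re • v + c.im • Complex.I • v := by
    conv_lhs => rw [← Complex.re_add_im c, add_smul, mul_smul, Complex.coe_smul, Complex.coe_smul]
  rw [h, map_add, map_smul, map_smul, Complex.real_smul, Complex.real_smul]

theorem wirt_smul (c : ℂ) (v : V) : wirt f (c • v) u = c * wirt f v u := by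
  rw [wirt, wirt, smul_smul, fderiv_complex_smul, fderiv_complex_smul f u (Complex.I * c)]
  conv_rhs => rw [← Complex.re_add_im c]
  simp only [Complex.mul_re, Complex.mul_im, Complex.I_re, Complex.I_im, Complex.ofReal_sub,
    Complex.ofReal_add, Complex.ofReal_mul, Complex.ofReal_zero, Complex.ofReal_one]
  linear_combination (1 / 2 * (c.im : ℂ) * fderiv ℝ f u (Complex.I • v)) * Complex.I_mul_I

theorem wirtBar_smul (c : ℂ) (v : V) : wirtBar f (c • v) u = conj c * wirtBar f v u := by
  rw [wirtBar, wirtBar, smul_smul, fderiv_complex_smul, fderiv_complex_smul f u (Complex.I * c)]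
  conv_rhs => rw [← Complex.re_add_im c]
  simp only [Complex.mul_re, Complex.mul_im, Complex.I_re, Complex.I_im, Complex.ofReal_sub,
    Complex.ofReal_add, Complex.ofReal_mul, Complex.ofReal_zero, Complex.ofReal_one, map_add,
    map_mul, Complex.conj_ofReal, Complex.conj_I]
  linear_combination (1 / 2 * (c.im : ℂ) * fderiv ℝ f u (Complex.I • v)) * Complex.I_mul_I

theorem wirt_sum {ι : Type*} (s : Finset ι) (v : ι → V) :
    wirt f (∑ i ∈ s, v i) u = ∑ i ∈ s, wirt f (v i) u := by
  simp only [wirt, Finset.smul_sum, map_sum, Finset.mul_sum, ← Finset.sum_sub_distrib]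

theorem wirtBar_sum {ι : Type*} (s : Finset ι) (v : ι → V) :
    wirtBar f (∑ i ∈ s, v i) u = ∑ i ∈ s, wirtBar f (v i) u := by
  simp only [wirtBar, Finset.smul_sum, map_sum, Finset.mul_sum, ← Finset.sum_add_distrib]

variable {f u}

theorem wirtBar_eq_conj_wirt {S : Opens V} (hf : ContDiffOn ℝ ∞ f S)
    (hr : ∀ x ∈ S, conj (f x) = f x) (hu : u ∈ S) (v : V) :
    wirtBar f v u = conj (wirt f v u) := by
  obtain ⟨a, ha⟩ := exists_of_contDiffOn hf
  have h1 : conjFun a = a := (ha.conj.congr fun x hx => (hr x hx).symm).unique ha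
  have h2 := conjFun_wirtD v a
  rw [h1] at h2
  exact (ha.wirtBar v ⟨u, hu⟩).trans ((congrFun (congrArg Subtype.val h2.symm) ⟨u, hu⟩).trans
    ((ha.wirt v).conj ⟨u, hu⟩).symm)

end WirtingerLinear

section Coordinates

variable {n : ℕ} (f : Cn n × Cn n → ℂ) (u : Cn n × Cn n) (w : Cn n)

theorem fibre_vector_eq_sum :
    ((0, w) : Cn n × Cn n) = ∑ i, w i • ((0, Pi.single i 1) : Cn n × Cn n) := by
  ext i <;> simp [Prod.fst_sum, Prod.snd_sum, Finset.sum_apply, Pi.single_apply]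

theorem base_vector_eq_sum :
    ((w, 0) : Cn n × Cn n) = ∑ i, w i • ((Pi.single i 1, 0) : Cn n × Cn n) := by
  ext i <;> simp [Prod.fst_sum, Prod.snd_sum, Finset.sum_apply, Pi.single_apply]

theorem wirt_fibre : wirt f (0, w) u = ∑ i, w i * dEta i f u := by
  rw [fibre_vector_eq_sum, wirt_sum]
  simp only [wirt_smul, dEta]

theorem fderiv_fibre : fderiv ℝ f u (0, w) =
    ∑ i, w i * dEta i f u + ∑ i, conj (w i) * dEtaBar i f u := by
  rw [fderiv_eq_wirt_add_wirtBar, wirt_fibre, fibre_vector_eq_sum, wirtBar_sum]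
  simp only [wirtBar_smul, dEtaBar]

theorem fderiv_base : fderiv ℝ f u (w, 0) =
    ∑ i, w i * dz i f u + ∑ i, conj (w i) * dzBar i f u := by
  rw [fderiv_eq_wirt_add_wirtBar, base_vector_eq_sum, wirtBar_sum, wirt_sum]
  simp only [wirtBar_smul, wirt_smul, dz, dzBar]

variable {f u}

/-- A function with vanishing fibre derivatives is constant on the punctured fibres. -/
theorem eq_on_fibre (hn : 0 < n) {z : Cn n}
    (hd : ∀ η : Cn n, η ≠ 0 → DifferentiableAt ℝ f (z, η))
    (h1 : ∀ η : Cn n, η ≠ 0 → ∀ i, dEta i f (z, η) = 0)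
    (h2 : ∀ η : Cn n, η ≠ 0 → ∀ i, dEtaBar i f (z, η) = 0)
    {η η' : Cn n} (hη : η ≠ 0) (hη' : η' ≠ 0) : f (z, η) = f (z, η') := by
  have hder : ∀ η : Cn n, η ≠ 0 → HasFDerivAt (fun η => f (z, η)) (0 : Cn n →L[ℝ] ℂ) η := by
    intro η hη
    have h3 := (hd η hη).hasFDerivAt.comp η (hasFDerivAt_prodMk_right (𝕜 := ℝ) z η)
    have h5 : fderiv ℝ f (z, η) ∘L ContinuousLinearMap.inr ℝ (Cn n) (Cn n) = 0 := by
      ext1 w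
      have h4 := fderiv_fibre f (z, η) w
      simp only [h1 η hη, h2 η hη, mul_zero, Finset.sum_const_zero, add_zero] at h4
      exact h4
    rw [h5] at h3
    exact h3
  -- Real dimension 2n > 1 makes the punctured fibre connected.
  have hrank : 1 < Module.rank ℝ (Cn n) := by
    rw [← Module.finrank_eq_rank, Module.finrank_pi_fintype]
    simp only [Complex.finrank_real_complex, Finset.sum_const, Finset.card_univ,
      Fintype.card_fin, smul_eq_mul]
    exact_mod_cast (by omega : 1 < n * 2)
  exact (isOpen_compl_singleton (x := (0 : Cn n))).is_const_of_fderiv_eq_zero (𝕜 := ℝ)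
    (isConnected_compl_singleton_of_one_lt_rank hrank 0).isPreconnected
    (fun η hη => (hder η hη).differentiableAt.differentiableWithinAt)
    (fun η hη => (hder η hη).fderiv) hη hη'

end Coordinates

/-! ### Propagation of zeros by a Grönwall estimate. -/

theorem eq_zero_of_norm_deriv_le {f f' : ℝ → ℂ} {c : ℝ → ℝ}
    (hc : ContinuousOn c (Set.Icc 0 1)) (hf : ∀ t ∈ Set.Icc (0 : ℝ) 1, HasDerivAt f (f' t) t)
    (h0 : f 0 = 0) (hb : ∀ t ∈ Set.Icc (0 : ℝ) 1, ‖f' t‖ ≤ c t * ‖f t‖) : f 1 = 0 := by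
  obtain ⟨C, hC⟩ := isCompact_Icc.exists_bound_of_continuousOn hc
  refine eq_zero_of_abs_deriv_le_mul_abs_self_of_eq_zero_right (f := f) (f' := f') (K := C)
    (a := 0) (b := 1)
    (fun t ht => (hf t ht).continuousAt.continuousWithinAt)
    (fun t ht => (hf t (Set.Ico_subset_Icc_self ht)).hasDerivWithinAt) h0
    (fun t ht => ?_) 1 (by simp)
  have ht' := Set.Ico_subset_Icc_self ht
  refine (hb t ht').trans ?_
  gcongr
  exact (le_abs_self _).trans (hC t ht')

/-- A real function whose horizontal derivatives are controlled by its own size vanishes along a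
segment in the base as soon as it vanishes at one end. -/
theorem eq_zero_of_segment {n : ℕ} {S : Opens (Cn n × Cn n)} {κ : Cn n × Cn n → ℂ}
    (hκ : ContDiffOn ℝ ∞ κ S) (hr : ∀ u ∈ S, conj (κ u) = κ u)
    {θ : Fin n → Cn n × Cn n → ℂ} (hθ : ∀ m, ContDiffOn ℝ ∞ (θ m) S)
    (hdz : ∀ u ∈ S, ∀ m, κ u * dz m κ u = κ u ^ 2 * θ m u)
    {z w η : Cn n} (hseg : ∀ t ∈ Set.Icc (0 : ℝ) 1, (z + t • w, η) ∈ S)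
    (h0 : κ (z, η) = 0) : κ (z + w, η) = 0 := by
  have hγ : ∀ t : ℝ, HasDerivAt (fun t : ℝ => ((z + t • w, η) : Cn n × Cn n)) (w, 0) t := by
    intro t
    have h1 : HasDerivAt (fun t : ℝ => z + t • w) w t := by
      simpa using ((hasDerivAt_id t).smul_const w).const_add z
    exact h1.prodMk (hasDerivAt_const t η)
  have hγc : Continuous (fun t : ℝ => ((z + t • w, η) : Cn n × Cn n)) :=
    continuous_iff_continuousAt.2 fun t => (hγ t).continuousAt
  -- Only κ ∂κ is controlled, so the estimate is for κ². The factor 4 is the 2 from differentiating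
  -- the square times 2 for the z and z̄ derivatives, conjugate to each other because κ is real.
  have key := eq_zero_of_norm_deriv_le
    (f := fun t => κ (z + t • w, η) ^ 2)
    (f' := fun t => 2 * κ (z + t • w, η) * fderiv ℝ κ (z + t • w, η) (w, 0))
    (c := fun t => 4 * ∑ m, ‖w m‖ * ‖θ m (z + t • w, η)‖) ?_ ?_ ?_ ?_
  · simpa using key
  · refine continuousOn_const.mul (continuousOn_finsetSum _ fun m _ =>
      continuousOn_const.mul ?_)
    exact ((hθ m).continuousOn.comp hγc.continuousOn hseg).norm
  · intro t ht
    have h1 := ((hκ.contDiffAt (S.isOpen.mem_nhds (hseg t ht))).differentiableAt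
      (by simp)).hasFDerivAt.comp_hasDerivAt t (hγ t)
    refine (h1.pow 2).congr_deriv ?_
    simp [mul_assoc]
  · simp [h0]
  · intro t ht
    set u : Cn n × Cn n := (z + t • w, η) with hu
    have huS : u ∈ S := hseg t ht
    have h1 : ∀ m, κ u * dzBar m κ u = conj (κ u ^ 2 * θ m u) := by
      intro m
      rw [← hdz u huS m, map_mul, hr u huS, dzBar, wirtBar_eq_conj_wirt hκ hr huS, dz]
    have h2 : 2 * κ u * fderiv ℝ κ u (w, 0) =
        2 * (∑ m, w m * (κ u ^ 2 * θ m u) + ∑ m, conj (w m) * conj (κ u ^ 2 * θ m u)) := by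
      rw [fderiv_base, mul_assoc, mul_add, Finset.mul_sum, Finset.mul_sum]
      congr 2
      · exact Finset.sum_congr rfl fun m _ => by rw [← hdz u huS m]; ring
      · exact Finset.sum_congr rfl fun m _ => by rw [← h1 m]; ring
    rw [h2, norm_mul]
    have h3 : ‖∑ m, w m * (κ u ^ 2 * θ m u)‖ ≤ (∑ m, ‖w m‖ * ‖θ m u‖) * ‖κ u ^ 2‖ := by
      refine (norm_sum_le _ _).trans (le_of_eq ?_)
      rw [Finset.sum_mul]
      exact Finset.sum_congr rfl fun m _ => by rw [norm_mul, norm_mul]; ring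
    have h4 : ‖∑ m, conj (w m) * conj (κ u ^ 2 * θ m u)‖ ≤
        (∑ m, ‖w m‖ * ‖θ m u‖) * ‖κ u ^ 2‖ := by
      refine (norm_sum_le _ _).trans (le_of_eq ?_)
      rw [Finset.sum_mul]
      exact Finset.sum_congr rfl fun m _ => by
        rw [norm_mul, RCLike.norm_conj, RCLike.norm_conj, norm_mul]; ring
    have h5 := norm_add_le (∑ m, w m * (κ u ^ 2 * θ m u))
      (∑ m, conj (w m) * conj (κ u ^ 2 * θ m u))
    rw [Complex.norm_ofNat]
    linarith

/-! ### Charts of a complex Finsler space give local Lagrangians. -/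

section Charts

variable {n : ℕ} {M : Type*} [TopologicalSpace M] [ChartedSpace (Cn n) M]
  {e : OpenPartialHomeomorph M (Cn n)}

/-- The slit domain of a chart as an open set. -/
def slitOpens (e : OpenPartialHomeomorph M (Cn n)) : Opens (Cn n × Cn n) :=
  ⟨slitDomain e, (e.open_target.preimage continuous_fst).inter
    (isOpen_compl_singleton.preimage continuous_snd)⟩

variable [IsManifold 𝓘(ℂ, Cn n) ω M]

theorem mfderiv_symm_bijective (he : e ∈ atlas (Cn n) M) {z : Cn n} (hz : z ∈ e.target) :
    Function.Bijective (mfderiv 𝓘(ℂ, Cn n) 𝓘(ℂ, Cn n) e.symm z) :=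
  (mdifferentiable_of_mem_atlas (I := 𝓘(ℂ, Cn n)) he).symm.mfderiv_bijective hz

theorem exists_coordVec_eq (he : e ∈ atlas (Cn n) M) {z : Cn n} (hz : z ∈ e.target)
    {v : TangentSpace 𝓘(ℂ, Cn n) (e.symm z)} (hv : v ≠ 0) :
    ∃ η : Cn n, η ≠ 0 ∧ coordVec e (z, η) = ⟨e.symm z, v⟩ := by
  obtain ⟨η, hη⟩ := (mfderiv_symm_bijective he hz).2 v
  refine ⟨η, ?_, ?_⟩
  · rintro rfl
    exact hv (hη.symm.trans (map_zero _))
  · rw [coordVec]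
    exact congrArg _ hη

theorem coordVec_snd_ne_zero (he : e ∈ atlas (Cn n) M) {u : Cn n × Cn n}
    (hu : u ∈ slitDomain e) :
    mfderiv 𝓘(ℂ, Cn n) 𝓘(ℂ, Cn n) e.symm u.1 u.2 ≠ 0 := fun h =>
  hu.2 ((mfderiv_symm_bijective he hu.1).1 (h.trans (map_zero _).symm))

variable {F : TangentBundle 𝓘(ℂ, Cn n) M → ℝ}

theorem localL_smul (hF : IsComplexFinsler F) (z η : Cn n) (c : ℂ) :
    localL F e (z, c • η) = ((‖c‖ ^ 2 : ℝ) : ℂ) * localL F e (z, η) := by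
  have h : coordVec e (z, c • η) =
      ⟨e.symm z, c • (mfderiv 𝓘(ℂ, Cn n) 𝓘(ℂ, Cn n) e.symm z η)⟩ := by
    rw [coordVec]
    exact congrArg _ (map_smul _ c η)
  rw [localL, h, hF.homogeneous, mul_pow, Complex.ofReal_mul]
  rfl

/-- Differentiate L(z, (1 + tc)η) = |1 + tc|² L(z, η) at t = 0. The cases c = 1 and c = i combine to
Euler's identity for the (1,0) derivative. -/
theorem fderiv_localL_fibre (hF : IsComplexFinsler F) {u : Cn n × Cn n}
    (hd : DifferentiableAt ℝ (localL F e) u) (c : ℂ) :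
    fderiv ℝ (localL F e) u (0, c • u.2) = 2 * c.re * localL F e u := by
  have h1 : HasDerivAt (fun t : ℝ => ((u.1, u.2 + t • (c • u.2)) : Cn n × Cn n))
      (0, c • u.2) 0 := by
    have h : HasDerivAt (fun t : ℝ => u.2 + t • (c • u.2)) (c • u.2) 0 := by
      simpa using ((hasDerivAt_id (0 : ℝ)).smul_const (c • u.2)).const_add u.2
    exact (hasDerivAt_const (0 : ℝ) u.1).prodMk h
  have hu : ((u.1, u.2 + (0 : ℝ) • (c • u.2)) : Cn n × Cn n) = u := by simp
  have h2 : HasDerivAt (fun t : ℝ => localL F e (u.1, u.2 + t • (c • u.2)))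
      (fderiv ℝ (localL F e) u (0, c • u.2)) 0 := by
    refine HasFDerivAt.comp_hasDerivAt (l := localL F e) (0 : ℝ) ?_ h1
    rw [hu]
    exact hd.hasFDerivAt
  have h3 : (fun t : ℝ => localL F e (u.1, u.2 + t • (c • u.2))) =
      fun t : ℝ => (((1 + t * c.re) ^ 2 + (t * c.im) ^ 2 : ℝ) : ℂ) * localL F e u := by
    funext t
    have h : u.2 + t • (c • u.2) = (1 + t * c : ℂ) • u.2 := by
      rw [add_smul, one_smul, mul_smul, Complex.coe_smul]
    rw [h, localL_smul hF]
    congr 2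
    rw [Complex.sq_norm, Complex.normSq_apply]
    simp
    ring
  rw [h3] at h2
  have h4 : HasDerivAt (fun t : ℝ => (1 + t * c.re) ^ 2 + (t * c.im) ^ 2) (2 * c.re) 0 := by
    have h5 := (((hasDerivAt_id (0 : ℝ)).mul_const c.re).const_add 1).pow 2
    have h6 := ((hasDerivAt_id (0 : ℝ)).mul_const c.im).pow 2
    refine (h5.add h6).congr_deriv ?_
    simp
  have h7 := (h4.ofReal_comp).mul_const (localL F e u)
  rw [h2.unique h7]
  push_cast
  ring

theorem isLocalLagrangian (hF : IsComplexFinsler F) (he : e ∈ atlas (Cn n) M) :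
    IsLocalLagrangian (slitOpens e) (localL F e) where
  smooth := hF.smooth e he
  real u _ := Complex.conj_ofReal _
  euler u hu := by
    have hd : DifferentiableAt ℝ (localL F e) u :=
      ((hF.smooth e he).contDiffAt ((slitOpens e).isOpen.mem_nhds hu)).differentiableAt (by simp)
    rw [← wirt_fibre, wirt]
    have h1 := fderiv_localL_fibre hF hd 1
    have h2 := fderiv_localL_fibre hF hd Complex.I
    rw [one_smul] at h1
    rw [Prod.smul_mk, smul_zero, h1, h2]
    simp
  ne_zero u hu := by
    have h := coordVec_snd_ne_zero he hu
    rw [localL, coordVec]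
    exact_mod_cast pow_ne_zero 2 (fun h0 => h ((hF.eq_zero_iff _ _).1 h0))
  det_ne_zero u hu := (hF.posDef e he u hu).det_pos.ne'

end Charts

/-! ### The scalar curvature read in a chart. -/

section Curvature

variable {n : ℕ} {M : Type*} [TopologicalSpace M] [ChartedSpace (Cn n) M]
  {e : OpenPartialHomeomorph M (Cn n)} [IsManifold 𝓘(ℂ, Cn n) ω M]
  {F 𝒦 : TangentBundle 𝓘(ℂ, Cn n) M → ℝ}

/-- The scalar curvature function in the coordinates of a chart. -/
def localCurv (𝒦 : TangentBundle 𝓘(ℂ, Cn n) M → ℝ) (e : OpenPartialHomeomorph M (Cn n))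
    (u : Cn n × Cn n) : ℂ := (𝒦 (coordVec e u) : ℂ)

variable (hF : IsComplexFinsler F) (hR : HasCurvatureForm F 𝒦) (he : e ∈ atlas (Cn n) M)
include hF hR he

theorem contDiffOn_localCurv (i : Fin n) : ContDiffOn ℝ ∞ (localCurv 𝒦 e) (slitOpens e) :=
  (isLocalLagrangian hF he).contDiffOn_scalar_curvature (κ := localCurv 𝒦 e)
    (fun u hu r j m k => hR e he u hu r j m k) i
    (fun u hu => (hF.posDef e he u hu).diag_pos.ne')

theorem localCurv_eq_on_fibre (i : Fin n) {z η η' : Cn n} (hz : z ∈ e.target) (hη : η ≠ 0)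
    (hη' : η' ≠ 0) : 𝒦 (coordVec e (z, η)) = 𝒦 (coordVec e (z, η')) := by
  have hκ := contDiffOn_localCurv hF hR he i
  have hE : ∀ η : Cn n, η ≠ 0 → ∀ i, dEta i (localCurv 𝒦 e) (z, η) = 0 := fun η hη i =>
    (isLocalLagrangian hF he).dEta_scalar_curvature
      (fun u hu r j m k => hR e he u hu r j m k) hκ (u := (z, η)) ⟨hz, hη⟩ i
  refine Complex.ofReal_injective (eq_on_fibre (f := localCurv 𝒦 e) (Fin.pos i) (fun η hη => ?_)
    hE (fun η hη i => ?_) hη hη')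
  · exact (hκ.contDiffAt ((slitOpens e).isOpen.mem_nhds ⟨hz, hη⟩)).differentiableAt (by simp)
  · rw [dEtaBar, wirtBar_eq_conj_wirt hκ (fun u _ => Complex.conj_ofReal _)
      (u := (z, η)) ⟨hz, hη⟩]
    rw [← dEta, hE η hη, map_zero]

theorem localCurv_eq_zero_of_segment {i j : Fin n} (hij : i ≠ j) {z w η : Cn n} (hη : η ≠ 0)
    (hseg : ∀ t ∈ Set.Icc (0 : ℝ) 1, z + t • w ∈ e.target)
    (h0 : 𝒦 (coordVec e (z, η)) = 0) : 𝒦 (coordVec e (z + w, η)) = 0 := by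
  have hκ := contDiffOn_localCurv hF hR he i
  -- The Schur-type identity for ∂_m needs a second index different from m; this is where dimension
  -- at least 2 enters.
  have hσ : ∀ m : Fin n, ∃ k, m ≠ k := fun m => by
    by_cases h : m = i
    · exact ⟨j, h ▸ hij⟩
    · exact ⟨i, h⟩
  choose σ hσ using hσ
  have h := eq_zero_of_segment (S := slitOpens e) hκ (fun u _ => Complex.conj_ofReal _)
    (fun m => (isLocalLagrangian hF he).contDiffOn_torsion m (σ m))
    (fun u hu m => (isLocalLagrangian hF he).scalar_curvature_mul_dz
      (fun u hu r j m k => hR e he u hu r j m k) hκ hu (hσ m))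
    (z := z) (w := w) (η := η) (fun t ht => ⟨hseg t ht, hη⟩)
    (by rw [localCurv, h0, Complex.ofReal_zero])
  exact Complex.ofReal_eq_zero.1 h

theorem gMatrix_eq_on_fibre (i : Fin n) (h0 : ∀ u ∈ slitDomain e, 𝒦 (coordVec e u) ≠ 0)
    {z η η' : Cn n} (hz : z ∈ e.target) (hη : η ≠ 0) (hη' : η' ≠ 0) :
    gMatrix (localL F e) (z, η) = gMatrix (localL F e) (z, η') := by
  have hκ := contDiffOn_localCurv hF hR he i
  have hL := isLocalLagrangian hF he
  have hg : ∀ η : Cn n, η ≠ 0 → ∀ j k m, dEta j (g (localL F e) k m) (z, η) = 0 ∧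
      dEtaBar j (g (localL F e) k m) (z, η) = 0 := fun η hη j k m =>
    hL.dEta_dEtaBar_g_eq_zero (κ := localCurv 𝒦 e) (fun u hu r j m k => hR e he u hu r j m k) hκ
      (fun u hu => Complex.ofReal_ne_zero.2 (h0 u hu)) (u := (z, η)) ⟨hz, hη⟩ j k m
  ext k m
  exact eq_on_fibre (f := g (localL F e) k m) (Fin.pos i)
    (fun η hη => (hL.rep_g k m).differentiableAt ⟨(z, η), hz, hη⟩)
    (fun η hη j => (hg η hη j k m).1) (fun η hη j => (hg η hη j k m).2) hη hη'

theorem curv_eq_of_mem_source (i : Fin n) {p : M} (hp : p ∈ e.source)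
    {v : TangentSpace 𝓘(ℂ, Cn n) p} (hv : v ≠ 0) {η : Cn n} (hη : η ≠ 0) :
    𝒦 ⟨p, v⟩ = 𝒦 (coordVec e (e p, η)) := by
  -- Replacing p by `e.symm z` puts v in the tangent space used by `coordVec`, with no transport
  -- between fibres.
  obtain ⟨z, hz, rfl⟩ : ∃ z ∈ e.target, e.symm z = p := ⟨e p, e.map_source hp, e.left_inv hp⟩
  obtain ⟨η', hη', h⟩ := exists_coordVec_eq he hz hv
  rw [← h, e.right_inv hz]
  exact localCurv_eq_on_fibre hF hR he i hz hη' hη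

end Curvature

/-! ### The zero set of the curvature on the base. -/

section Dichotomy

variable {n : ℕ} {M : Type*} [TopologicalSpace M] [ChartedSpace (Cn n) M]
  [IsManifold 𝓘(ℂ, Cn n) ω M] {F 𝒦 : TangentBundle 𝓘(ℂ, Cn n) M → ℝ}

theorem exists_curv_on_base (hF : IsComplexFinsler F) (hR : HasCurvatureForm F 𝒦) (i : Fin n) :
    ∃ κ : M → ℝ, (∀ (p : M) (v : TangentSpace 𝓘(ℂ, Cn n) p), v ≠ 0 → 𝒦 ⟨p, v⟩ = κ p) ∧
      ∀ e ∈ atlas (Cn n) M, ∀ p ∈ e.source, ∀ η : Cn n, η ≠ 0 →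
        κ p = 𝒦 (coordVec e (e p, η)) := by
  have hη : (Pi.single i 1 : Cn n) ≠ 0 := by simp
  have h1 : ∀ (p : M) (v : TangentSpace 𝓘(ℂ, Cn n) p), v ≠ 0 → 𝒦 ⟨p, v⟩ =
      𝒦 (coordVec (chartAt (Cn n) p) (chartAt (Cn n) p p, Pi.single i 1)) := fun p v hv =>
    curv_eq_of_mem_source hF hR (chart_mem_atlas _ p) i (mem_chart_source _ p) hv hη
  refine ⟨_, h1, fun e he p hp η hη' => ?_⟩
  have hv : (show TangentSpace 𝓘(ℂ, Cn n) p from (Pi.single i 1 : Cn n)) ≠ 0 := hη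
  rw [← h1 p _ hv]
  exact curv_eq_of_mem_source hF hR he i hp hv hη'

/-- Closed by continuity in a chart; open because a zero spreads along the radii of a coordinate
ball about it. -/
theorem isClopen_curv_zero (hF : IsComplexFinsler F) (hR : HasCurvatureForm F 𝒦) {i j : Fin n}
    (hij : i ≠ j) {κ : M → ℝ} (hκ : ∀ e ∈ atlas (Cn n) M, ∀ p ∈ e.source, ∀ η : Cn n, η ≠ 0 →
        κ p = 𝒦 (coordVec e (e p, η))) : IsClopen {p | κ p = 0} := by
  have hη : (Pi.single i 1 : Cn n) ≠ 0 := by simp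
  constructor
  · rw [← isOpen_compl_iff, isOpen_iff_mem_nhds]
    intro p hp
    have he := chart_mem_atlas (Cn n) p
    have hps := mem_chart_source (Cn n) p
    set e := chartAt (Cn n) p
    have hu : ((e p, Pi.single i 1) : Cn n × Cn n) ∈ slitOpens e := ⟨e.map_source hps, hη⟩
    have hc : ContinuousAt (fun q => localCurv 𝒦 e (e q, Pi.single i 1)) p := by
      refine ContinuousAt.comp (f := fun q => ((e q, Pi.single i 1) : Cn n × Cn n))
        (g := localCurv 𝒦 e) ?_
        ((e.continuousAt hps).prodMk continuousAt_const)
      exact (contDiffOn_localCurv hF hR he i).continuousOn.continuousAt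
        ((slitOpens e).isOpen.mem_nhds hu)
    have hne : localCurv 𝒦 e (e p, Pi.single i 1) ≠ 0 := by
      rw [localCurv, ← hκ e he p hps _ hη]
      exact Complex.ofReal_ne_zero.2 hp
    filter_upwards [hc.eventually_ne hne, e.open_source.mem_nhds hps] with q hq hqs h0
    refine hq ?_
    rw [localCurv, ← hκ e he q hqs _ hη, h0, Complex.ofReal_zero]
  · rw [isOpen_iff_mem_nhds]
    intro p hp
    have he := chart_mem_atlas (Cn n) p
    have hps := mem_chart_source (Cn n) p
    set e := chartAt (Cn n) p
    obtain ⟨r, hr, hball⟩ := Metric.isOpen_iff.1 e.open_target (e p) (e.map_source hps)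
    filter_upwards [(e.continuousAt hps).preimage_mem_nhds (Metric.ball_mem_nhds _ hr),
      e.open_source.mem_nhds hps] with q hq hqs
    have h0 : 𝒦 (coordVec e (e p, Pi.single i 1)) = 0 := (hκ e he p hps _ hη).symm.trans hp
    have h1 := localCurv_eq_zero_of_segment hF hR he hij hη (w := e q - e p) (fun t ht => ?_) h0
    · rw [add_sub_cancel] at h1
      exact (hκ e he q hqs _ hη).trans h1
    · exact hball ((convex_ball (e p) r).add_smul_sub_mem (Metric.mem_ball_self hr) hq ht)

theorem isPurelyHermitian_of_curv_ne_zero (hF : IsComplexFinsler F) (hR : HasCurvatureForm F 𝒦)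
    (i : Fin n) (h0 : ∀ (p : M) (v : TangentSpace 𝓘(ℂ, Cn n) p), v ≠ 0 → 𝒦 ⟨p, v⟩ ≠ 0) :
    IsPurelyHermitian F := fun e he =>
  ⟨fun z => gMatrix (localL F e) (z, Pi.single i 1), fun _ hu =>
    gMatrix_eq_on_fibre hF hR he i (fun _ hu => h0 _ _ (coordVec_snd_ne_zero he hu)) hu.1 hu.2
      (by simp)⟩

end Dichotomy

end CFinsler

end

theorem corollary4p6 {M : Type*} [TopologicalSpace M] [ConnectedSpace M]
    [ChartedSpace (CFinsler.Cn 2) M] [IsManifold 𝓘(ℂ, CFinsler.Cn 2) ω M]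
    (F : TangentBundle 𝓘(ℂ, CFinsler.Cn 2) M → ℝ) (hF : CFinsler.IsComplexFinsler F)
    (𝒦 : TangentBundle 𝓘(ℂ, CFinsler.Cn 2) M → ℝ) (hR : CFinsler.HasCurvatureForm F 𝒦) :
    (CFinsler.IsPurelyHermitian F ∧
      ∃ κ : M → ℝ, ∀ (p : M) (v : TangentSpace 𝓘(ℂ, CFinsler.Cn 2) p), v ≠ 0 → 𝒦 ⟨p, v⟩ = κ p) ∨
    (¬ CFinsler.IsPurelyHermitian F ∧
      ∀ (p : M) (v : TangentSpace 𝓘(ℂ, CFinsler.Cn 2) p), v ≠ 0 → 𝒦 ⟨p, v⟩ = 0) := by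
  obtain ⟨κ, hκ, hκ'⟩ := CFinsler.exists_curv_on_base hF hR 0
  by_cases hH : CFinsler.IsPurelyHermitian F
  · exact Or.inl ⟨hH, κ, hκ⟩
  refine Or.inr ⟨hH, fun p v hv => ?_⟩
  rw [hκ p v hv]
  rcases isClopen_iff.1 (CFinsler.isClopen_curv_zero hF hR (i := 0) (j := 1) (by simp) hκ')
    with h | h
  · refine absurd (CFinsler.isPurelyHermitian_of_curv_ne_zero hF hR 0 fun p v hv h0 => ?_) hH
    exact (Set.eq_empty_iff_forall_notMem.1 h p) ((hκ p v hv).symm.trans h0)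
  · exact Set.eq_univ_iff_forall.1 h p
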